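/- **Setting.** Fix $d\ge 1$, a price range $\mathcal P=[p_{\min},p_{\max}]$, a set of contexts $\mathcal X\subseteq\mathbb R^d$, a parameter class $\Theta\subseteq\mathbb R^d$ with convex hull $\overline\Theta$ (equal to $\Theta$ if $\Theta$ is convex), a measurable set $\mathcal D\subseteq\mathbb R$ of possible demands, a true parameter $\theta_0$, measurable functions $f(p,x;\theta)$ (demand function) and $\rho(y,p,x;\theta)$ (risk), a function $\nu(p,x;\theta)$, and a demand law $P(\cdot\mid p,x)$, a Markov kernel. For every horizon $T$ there is a probability space carrying contexts $x_t\in\mathcal X$, prices $p_t\in\mathcal P$ and demands $d_t\in\mathcal D$, $t=1,\dots,T$, collected adaptively: with $\mathcal F_{t-1}=\{(x_s,p_s,d_s)\}_{s<t}$, the context $x_t$ has a conditional law $\mathcal C_t(\mathcal F_{t-1})$ given $\mathcal F_{t-1}$, the price $p_t$ has an arbitrary conditional law given $(\mathcal F_{t-1},x_t)$ (the pricing strategy), and $d_t$ has conditional law $P(\cdot\mid p_t,x_t)$ given $(\mathcal F_{t-1},x_t,p_t)$. The processes and strategies may depend on $T$. Put $\xi_t=d_t-f(p_t,x_t;\theta_0)$.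 **Assumptions.** Unless said otherwise, they are for all $p\in\mathcal P$, $x\in\mathcal X$, $\theta\in\overline\Theta$, $y\in\mathcal D$, with bounds uniform in these and in $T$, $t$. - (A1) $\mathcal X$ and $\Theta$ are compact and $\theta_0\in\Theta$. - (A2) $f$ is continuously differentiable in $\theta$; $f$ and $\nabla_\theta f$ are bounded, and $\nabla_\theta f$ is Lipschitz in $\theta$. - (B1) For $y\sim P(\cdot\mid p,x)$: $y\in\mathcal D$ a.s., $y-f(p,x;\theta_0)$ has mean zero and is a.s. bounded. - (B2) For $y\sim P(\cdot\mid p,x)$, $\mathbb E[(y-f(p,x;\theta_0))^2]=\nu(p,x;\theta_0)^2$; $\nu$ is Lipschitz in $\theta\in\Theta$; and $0<\inf_{p,x}\nu(p,x;\theta_0)\le\sup_{p,x}\nu(p,x;\theta_0)<\infty$. - (C1) $\rho$ is three times continuously differentiable in $\theta$; $\rho$ and its $\theta$-derivatives of orders $1,2,3$ are bounded. - (C2) $\mathbb E_{y\sim P(\cdot\mid p,x)}[\nabla_\theta\rho(y,p,x;\theta_0)]=0$. - (D1) There is $\kappa_0>0$ such that for all $T$ and $t\le T$, almost surely, for all measurable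 $y(\cdot)\in\mathcal D$, $p(\cdot)\in\mathcal P$, $\theta(\cdot)\in\overline\Theta$ (functions of the context), $$\lambda_{\min}\big(\mathbb E_{x\sim\mathcal C_t(\mathcal F_{t-1})}[\nabla_\theta f\,\nabla_\theta f^\top(p(x),x;\theta(x))]\big)\ge\kappa_0,\qquad \lambda_{\min}\big(\mathbb E_{x\sim\mathcal C_t(\mathcal F_{t-1})}[\nabla^2_{\theta\theta}\rho(y(x),p(x),x;\theta(x))]\big)\ge\kappa_0 .$$ **Estimates and whitening matrix.** Let $\hat\theta_t\in\arg\min_{\theta\in\Theta}\sum_{s<t}\rho(d_s,p_s,x_s;\theta)$ be chosen by a measurable rule depending only on the data of the periods $s<t$, and let $\hat\theta^{\mathsf p}=\hat\theta_{T+1}$. Given $\eta=\eta_T$, start with $Z=I_d$; for $t=1,\dots,T$ let $u_t=\nabla_\theta f(p_t,x_t;\hat\theta_t)$ and $w_t=Zu_t/\|u_t\|_2^2$ ($w_t=0$ if $u_t=0$); if $\|w_t\|_2\ge\eta$, replace $w_t$ by $\eta w_t/\|w_t\|_2$; then replace $Z$ by $Z-w_tu_t^\top$. Let $W=(w_1,\dots,w_T)\in\mathbb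 R^{d\times T}$, let $G\in\mathbb R^{T\times d}$ have rows $\nabla_\theta f(p_t,x_t;\hat\theta^{\mathsf p})^\top$, and let $D=\mathrm{diag}(\nu(p_t,x_t;\theta_0)^2)_{t\le T}$. **Claim.** Under (A1), (A2), (B1), (B2), (C1), (C2), (D1), if $\eta T\to\infty$ and $\eta T^{1/2+\delta}\to0$ for some $\delta>0$, then: 1. for all $T$ and $t\le T$, $w_t$ is measurable with respect to the $\sigma$-algebra generated by $\{\xi_s,p_s,d_s,x_s,w_s\}_{s<t}\cup\{x_t,p_t\}$; 2. $\mathbb E\big[\sum_{t=1}^T\|w_t\|_2^3\big]$ is finite for every $T$ and tends to $0$ as $T\to\infty$; 3. as $T\to\infty$, $$\frac{\max\{\|I_d-WG\|_{\mathrm{op}}\,\|\hat\theta^{\mathsf p}-\theta_0\|_2,\ \|\hat\theta^{\mathsf p}-\theta_0\|_2^2\}}{\min\{1,\sqrt{\lambda_{\min}(WDW^\top)}\}}\ \overset{p}{\to}\ 0 .$$ Moreover $\lambda_{\min}(WDW^\top)=\Omega(1/T)$ with probability tending to one: there is a constant $c>0$ with $\Pr[\lambda_{\min}(WDW^\top)\ge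 c/T]\to1$ as $T\to\infty$. -/

import Mathlib

open MeasureTheory ProbabilityTheory Filter Topology

noncomputable section

namespace DynamicPricing

/-- The space `ℝᵈ` with its Euclidean norm. -/
abbrev Vec (d : ℕ) : Type := EuclideanSpace ℝ (Fin d)

/-- The record `(x_t, p_t, d_t)` of one selling period: context, price, realized demand. -/
abbrev Obs (d : ℕ) : Type := Vec d × ℝ × ℝ

/-! ### Matrices -/

/-- The smallest eigenvalue of a symmetric real matrix. -/
def lamMin {d : ℕ} (A : Matrix (Fin d) (Fin d) ℝ) : ℝ := sInf (spectrum ℝ A)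

/-- The operator norm of a matrix acting on Euclidean space. -/
def opNorm {d : ℕ} (A : Matrix (Fin d) (Fin d) ℝ) : ℝ :=
  ‖Matrix.toEuclideanCLM (𝕜 := ℝ) A‖

/-- The product of a square matrix and a vector of Euclidean space. -/
def mulVecE {d : ℕ} (A : Matrix (Fin d) (Fin d) ℝ) (u : Vec d) : Vec d :=
  Matrix.toEuclideanCLM (𝕜 := ℝ) A u

/-- The Hessian matrix of `h` at `θ`. -/
def hessian {d : ℕ} (h : Vec d → ℝ) (θ : Vec d) : Matrix (Fin d) (Fin d) ℝ :=
  Matrix.of fun i j =>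
    iteratedFDeriv ℝ 2 h θ ![EuclideanSpace.single i 1, EuclideanSpace.single j 1]

/-! ### The demand model -/

/-- The ingredients of a contextual pricing model that do not depend on the horizon. -/
structure Model (d : ℕ) where
  /-- lowest price -/
  pMin : ℝ
  /-- highest price -/
  pMax : ℝ
  /-- the domain of the context vectors -/
  contexts : Set (Vec d)
  /-- the range of possible demands -/
  demands : Set ℝ
  /-- the parameter class -/
  Θ : Set (Vec d)
  /-- the true parameter -/
  θ₀ : Vec d
  /-- the demand function `f(p, x; θ)` -/
  f : ℝ → Vec d → Vec d → ℝ
  /-- the risk function `ρ(d, p, x; θ)` -/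
  ρ : ℝ → ℝ → Vec d → Vec d → ℝ
  /-- the standard deviation function `ν(p, x; θ)` of the noise -/
  ν : ℝ → Vec d → Vec d → ℝ
  /-- the law of the demand at price `p` and context `x` under the true parameter `θ₀` -/
  law : Kernel (ℝ × Vec d) ℝ

namespace Model

variable {d : ℕ} (M : Model d)

/-- The price range `[p_min, p_max]`. -/
def prices : Set ℝ := Set.Icc M.pMin M.pMax

/-- The parameters over which the regularity assumptions range: the convex hull of `Θ`, which is
`Θ` itself when `Θ` is convex. -/
def params : Set (Vec d) := convexHull ℝ M.Θ

/-- (A1): compact sets of contexts and of parameters, the latter containing the true parameter.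
(That all prices and contexts lie in their ranges is a part of `SalesProcess`.) -/
structure A1 : Prop where
  contexts_compact : IsCompact M.contexts
  params_compact : IsCompact M.Θ
  true_mem : M.θ₀ ∈ M.Θ

/-- (A2): `f` is continuously differentiable in `θ`, with `f` and its gradient uniformly bounded
and the gradient uniformly Lipschitz in `θ`. -/
structure A2 : Prop where
  measurable : Measurable fun q : ℝ × Vec d × Vec d => M.f q.1 q.2.1 q.2.2
  smooth : ∀ p ∈ M.prices, ∀ x ∈ M.contexts, ∀ θ ∈ M.params, ContDiffAt ℝ 1 (M.f p x) θ
  bounded : ∃ B : ℝ, ∀ p ∈ M.prices, ∀ x ∈ M.contexts, ∀ θ ∈ M.params,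
    |M.f p x θ| ≤ B ∧ ‖gradient (M.f p x) θ‖ ≤ B
  lipschitz : ∃ L : ℝ, ∀ p ∈ M.prices, ∀ x ∈ M.contexts, ∀ θ ∈ M.params, ∀ θ' ∈ M.params,
    ‖gradient (M.f p x) θ - gradient (M.f p x) θ'‖ ≤ L * ‖θ - θ'‖

/-- (B1): under the demand law at `(p, x)` the demand lies in the range of demands, and the noise
`d - f(p, x; θ₀)` is centered and uniformly bounded (hence sub-Gaussian). That the noise variables
are conditionally independent given prices and contexts is `SalesProcess.demand_law`. -/
structure B1 : Prop where
  demands_measurable : MeasurableSet M.demands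
  markov : IsMarkovKernel M.law
  supported : ∀ p ∈ M.prices, ∀ x ∈ M.contexts, ∀ᵐ y ∂(M.law (p, x)), y ∈ M.demands
  bounded : ∃ B : ℝ, ∀ p ∈ M.prices, ∀ x ∈ M.contexts,
    ∀ᵐ y ∂(M.law (p, x)), |y - M.f p x M.θ₀| ≤ B
  centered : ∀ p ∈ M.prices, ∀ x ∈ M.contexts, ∫ y, (y - M.f p x M.θ₀) ∂(M.law (p, x)) = 0

/-- (B2): the noise at `(p, x)` has variance `ν(p, x; θ₀)²`; `ν` is Lipschitz in `θ`, and
`ν(·, ·; θ₀)` is bounded and bounded away from zero. -/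
structure B2 : Prop where
  variance : ∀ p ∈ M.prices, ∀ x ∈ M.contexts,
    ∫ y, (y - M.f p x M.θ₀) ^ 2 ∂(M.law (p, x)) = M.ν p x M.θ₀ ^ 2
  lipschitz : ∃ L : ℝ, ∀ p ∈ M.prices, ∀ x ∈ M.contexts, ∀ θ ∈ M.Θ, ∀ θ' ∈ M.Θ,
    |M.ν p x θ - M.ν p x θ'| ≤ L * ‖θ - θ'‖
  bounds : ∃ a b : ℝ, 0 < a ∧ ∀ p ∈ M.prices, ∀ x ∈ M.contexts,
    a ≤ M.ν p x M.θ₀ ∧ M.ν p x M.θ₀ ≤ b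

/-- (C1): `ρ` is three times continuously differentiable in `θ`, and `ρ` and its derivatives of
orders one, two and three are uniformly bounded. -/
structure C1 : Prop where
  measurable : Measurable fun q : ℝ × ℝ × Vec d × Vec d => M.ρ q.1 q.2.1 q.2.2.1 q.2.2.2
  smooth : ∀ y ∈ M.demands, ∀ p ∈ M.prices, ∀ x ∈ M.contexts, ∀ θ ∈ M.params,
    ContDiffAt ℝ 3 (M.ρ y p x) θ
  bounded : ∃ B : ℝ, ∀ y ∈ M.demands, ∀ p ∈ M.prices, ∀ x ∈ M.contexts, ∀ θ ∈ M.params,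
    ∀ k ≤ 3, ‖iteratedFDeriv ℝ k (M.ρ y p x) θ‖ ≤ B

/-- (C2): under the demand law, the gradient of `ρ` at the true parameter has mean zero. -/
def C2 : Prop :=
  ∀ p ∈ M.prices, ∀ x ∈ M.contexts, ∫ y, gradient (M.ρ y p x) M.θ₀ ∂(M.law (p, x)) = 0

end Model

/-! ### The data -/

/-- The data `(x_s, p_s, d_s)` of the periods `s < t`. -/
def historyOf {d : ℕ} {Ω : Type*} (x : ℕ → Ω → Vec d) (p y : ℕ → Ω → ℝ) (t : ℕ) (ω : Ω) :
    Fin t → Obs d :=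
  fun s => (x s ω, p s ω, y s ω)

/-- The data of `T` selling periods (numbered `0, …, T - 1`), collected by an arbitrary adaptive
pricing strategy: given the data of the earlier periods, `x_t` is drawn from `context t`; given
these data and `x_t`, the price `p_t` is drawn from `policy t`; given all of these, the demand
`d_t` is drawn from the demand law at `(p_t, x_t)`. -/
structure SalesProcess {d : ℕ} (M : Model d) (T : ℕ) {Ω : Type*} [MeasurableSpace Ω]
    (μ : Measure Ω) where
  /-- the contexts `x_t` -/
  x : ℕ → Ω → Vec d
  /-- the prices `p_t` -/
  p : ℕ → Ω → ℝ
  /-- the realized demands `d_t` -/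
  y : ℕ → Ω → ℝ
  /-- the context generation procedure, as a conditional law -/
  context : (t : ℕ) → Kernel (Fin t → Obs d) (Vec d)
  /-- the pricing strategy, as a conditional law -/
  policy : (t : ℕ) → Kernel ((Fin t → Obs d) × Vec d) ℝ
  x_measurable : ∀ t < T, Measurable (x t)
  p_measurable : ∀ t < T, Measurable (p t)
  y_measurable : ∀ t < T, Measurable (y t)
  x_mem : ∀ t < T, ∀ ω, x t ω ∈ M.contexts
  p_mem : ∀ t < T, ∀ ω, p t ω ∈ M.prices
  y_mem : ∀ t < T, ∀ ω, y t ω ∈ M.demands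
  context_markov : ∀ t < T, IsMarkovKernel (context t)
  policy_markov : ∀ t < T, IsMarkovKernel (policy t)
  context_law : ∀ t < T, HasCondDistrib (x t) (historyOf x p y t) (context t) μ
  policy_law : ∀ t < T,
    HasCondDistrib (p t) (fun ω => (historyOf x p y t ω, x t ω)) (policy t) μ
  demand_law : ∀ t < T,
    HasCondDistrib (y t) (fun ω => (historyOf x p y t ω, x t ω, p t ω))
      (M.law.comap (fun z : (Fin t → Obs d) × Vec d × ℝ => (z.2.2, z.2.1)) (by fun_prop)) μ

namespace SalesProcess

variable {d : ℕ} {M : Model d} {T : ℕ} {Ω : Type*} [MeasurableSpace Ω] {μ : Measure Ω}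
  (S : SalesProcess M T μ)

/-- The data of the periods before `t`. -/
def history (t : ℕ) (ω : Ω) : Fin t → Obs d := historyOf S.x S.p S.y t ω

/-- The noise `ξ_t = d_t - f(p_t, x_t; θ₀)`. -/
def ξ (t : ℕ) (ω : Ω) : ℝ := S.y t ω - M.f (S.p t ω) (S.x t ω) M.θ₀

/-- (D1) with the constant `κ`: given the past, when `x` is drawn from the conditional law of `x_t`,
`𝔼[∇f ∇fᵀ]` and `𝔼[∇²ρ]` have all their eigenvalues `≥ κ`, for every choice of the demand, price
and parameter, which may depend on `x`. -/
def D1 (κ : ℝ) : Prop :=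
  ∀ t < T, ∀ᵐ ω ∂μ, ∀ (yy pp : Vec d → ℝ) (θθ : Vec d → Vec d),
    Measurable yy → Measurable pp → Measurable θθ →
    (∀ x, yy x ∈ M.demands) → (∀ x, pp x ∈ M.prices) → (∀ x, θθ x ∈ M.params) →
      κ ≤ lamMin (Matrix.of fun i j : Fin d =>
        ∫ x, gradient (M.f (pp x) x) (θθ x) i * gradient (M.f (pp x) x) (θθ x) j
          ∂(S.context t (S.history t ω))) ∧
      κ ≤ lamMin (Matrix.of fun i j : Fin d =>
        ∫ x, hessian (M.ρ (yy x) (pp x) x) (θθ x) i j ∂(S.context t (S.history t ω)))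

end SalesProcess

/-! ### The pilot estimate -/

/-- `erm` is a (measurable) empirical risk minimization rule: on every data set of size `n` it
returns a minimizer over `Θ` of the total risk. -/
structure IsERM {d : ℕ} (M : Model d) (erm : (n : ℕ) → (Fin n → Obs d) → Vec d) : Prop where
  measurable : ∀ n, Measurable (erm n)
  mem : ∀ n (h : Fin n → Obs d),
    (∀ s, (h s).1 ∈ M.contexts ∧ (h s).2.1 ∈ M.prices ∧ (h s).2.2 ∈ M.demands) → erm n h ∈ M.Θ
  isMinOn : ∀ n (h : Fin n → Obs d),
    (∀ s, (h s).1 ∈ M.contexts ∧ (h s).2.1 ∈ M.prices ∧ (h s).2.2 ∈ M.demands) →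
      IsMinOn (fun θ => ∑ s, M.ρ (h s).2.2 (h s).2.1 (h s).1 θ) M.Θ (erm n h)

/-! ### The whitening procedure -/

/-- The new column for remainder `Z` and gradient `u`: `w = Z u / ‖u‖²`, replaced by `η w / ‖w‖` if
`‖w‖ ≥ η`. (If `u = 0`, then `w = 0`.) -/
def whitenColumn {d : ℕ} (η : ℝ) (Z : Matrix (Fin d) (Fin d) ℝ) (u : Vec d) : Vec d :=
  let w : Vec d := (‖u‖ ^ 2)⁻¹ • mulVecE Z u
  if η ≤ ‖w‖ then (η / ‖w‖) • w else w

/-- The matrix `Z` before step `t` of the procedure run on the gradients `u 0, u 1, …`. -/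
def whitenRemainder {d : ℕ} (η : ℝ) (u : ℕ → Vec d) : ℕ → Matrix (Fin d) (Fin d) ℝ
  | 0 => 1
  | t + 1 => whitenRemainder η u t -
      Matrix.vecMulVec (whitenColumn η (whitenRemainder η u t) (u t)) (u t)

namespace SalesProcess

variable {d : ℕ} {M : Model d} {T : ℕ} {Ω : Type*} [MeasurableSpace Ω] {μ : Measure Ω}
  (S : SalesProcess M T μ)

/-- The estimate computed from the data before period `t`. For `t = T` it uses all the data, and is
the pilot estimate `θ̂ᵖ`. -/
def pilot (erm : (n : ℕ) → (Fin n → Obs d) → Vec d) (t : ℕ) (ω : Ω) : Vec d :=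
  erm t (S.history t ω)

/-- The gradient `∇f(p_t, x_t; θ̂_t)` that the whitening procedure uses in period `t`. -/
def onlineGrad (erm : (n : ℕ) → (Fin n → Obs d) → Vec d) (t : ℕ) (ω : Ω) : Vec d :=
  gradient (M.f (S.p t ω) (S.x t ω)) (S.pilot erm t ω)

/-- The column `w_t` produced by the whitening procedure with parameter `η`. -/
def whiten (erm : (n : ℕ) → (Fin n → Obs d) → Vec d) (η : ℝ) (t : ℕ) (ω : Ω) : Vec d :=
  whitenColumn η (whitenRemainder η (fun s => S.onlineGrad erm s ω) t) (S.onlineGrad erm t ω)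

/-- The `d × T` matrix with columns `w_t`. -/
def matW (_S : SalesProcess M T μ) (w : ℕ → Ω → Vec d) (ω : Ω) : Matrix (Fin d) (Fin T) ℝ :=
  Matrix.of fun i t => w t ω i

/-- The `T × d` matrix `G` with rows `g_t = ∇f(p_t, x_t; θ̂ᵖ)`. -/
def matG (erm : (n : ℕ) → (Fin n → Obs d) → Vec d) (ω : Ω) : Matrix (Fin T) (Fin d) ℝ :=
  Matrix.of fun t i => gradient (M.f (S.p t ω) (S.x t ω)) (S.pilot erm T ω) i

/-- The diagonal matrix `D` of the conditional variances `ν(p_t, x_t; θ₀)²`. -/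
def matD (ω : Ω) : Matrix (Fin T) (Fin T) ℝ :=
  Matrix.diagonal fun t => M.ν (S.p t ω) (S.x t ω) M.θ₀ ^ 2

/-- `λ_min(W D Wᵀ)`. -/
def lamWDW (w : ℕ → Ω → Vec d) (ω : Ω) : ℝ :=
  lamMin (S.matW w ω * S.matD ω * (S.matW w ω).transpose)

/-- The information available when `w_t` is chosen: the `σ`-algebra generated by
`ξ_s, p_s, d_s, x_s, w_s` for `s < t`, and by `x_t, p_t`. -/
abbrev info (w : ℕ → Ω → Vec d) (t : ℕ) : MeasurableSpace Ω :=
  MeasurableSpace.comap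
    (fun ω => ((fun s : Fin t => (S.ξ s ω, S.p s ω, S.y s ω, S.x s ω, w s ω)), S.x t ω, S.p t ω))
    inferInstance

/-- The ratio that is required to tend to zero in probability. -/
def biasRatio (erm : (n : ℕ) → (Fin n → Obs d) → Vec d) (w : ℕ → Ω → Vec d) (ω : Ω) : ℝ :=
  max (opNorm (1 - S.matW w ω * S.matG erm ω) * ‖S.pilot erm T ω - M.θ₀‖)
      (‖S.pilot erm T ω - M.θ₀‖ ^ 2) /
    min 1 (Real.sqrt (S.lamWDW w ω))

end SalesProcess

/-- The non-anticipativity, small-norm and small-bias conditions on the whitening matrices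
`W_T = (w_0, …, w_{T-1})` as the horizon `T` tends to infinity. -/
structure WhiteningConditions {d : ℕ} {M : Model d} {Ω : ℕ → Type*}
    [∀ T, MeasurableSpace (Ω T)] {μ : (T : ℕ) → Measure (Ω T)}
    (S : (T : ℕ) → SalesProcess M T (μ T))
    (erm : (n : ℕ) → (Fin n → Obs d) → Vec d) (w : (T : ℕ) → ℕ → Ω T → Vec d) : Prop where
  nonanticipative : ∀ T, ∀ t < T, Measurable[(S T).info (w T) t] (w T t)
  integrable : ∀ T, Integrable (fun ω => ∑ t ∈ Finset.range T, ‖w T t ω‖ ^ 3) (μ T)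
  small_norm : Tendsto (fun T => ∫ ω, ∑ t ∈ Finset.range T, ‖w T t ω‖ ^ 3 ∂(μ T)) atTop (𝓝 0)
  small_bias : ∀ ε : ℝ, 0 < ε →
    Tendsto (fun T => (μ T) {ω | ε ≤ |(S T).biasRatio erm (w T) ω|}) atTop (𝓝 0)

end DynamicPricing

end

/-! Since `λ_min(W D Wᵀ)` is at least of order `1/T` with high probability, it suffices to show that
`√T (‖I - WG‖ ‖θ̂ᵖ - θ₀‖ + ‖θ̂ᵖ - θ₀‖²)` tends to zero in probability. Every probabilistic estimate
is a second-moment bound followed by Markov's inequality.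

Whitening. The new column is `a • Z u` with `0 ≤ a ≤ ‖u‖⁻²`, so the squared Frobenius norm of `Z`
drops by at least `a ‖Z u‖²`, and `a` may be replaced by `c η` here. Given the past, `Z` and the
current estimate are fixed, so (D1) bounds the conditional mean of `‖Z u‖²` below by `κ ‖Z‖²`. Hence
the mean of the final squared norm is at most `d exp(-c κ η T)` (`integral_residual_le`). Once `‖Z‖
≤ 1/2`, the identity `v = Z v + ∑ w_t ⟨u_t, v⟩` and Cauchy-Schwarz give the eigenvalue bound
(`sum_inner_sq_ge`, `le_lamWDW`).

Pilot estimate. At `θ₀` the summed gradients of the risk form a martingale with mean square `O(n)`;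
so do the entries of the Hessian sums minus their conditional means, at each point of a finite net
of parameters. If the latter are small, the empirical risk is strongly convex on the hull and the
error is controlled by the gradient; if not, the diameter of `Θ` bounds the error
(`erm_error_sq_le`). Both cases fit into one inequality whose expectation is `O(1/n)`
(`exists_integral_pilot_error_sq_le`).

Bias. `I - WG` is the final remainder plus `∑ w_t (u_t - g_t)ᵀ`, where `‖w_t‖ ≤ η` and `u_t - g_t`
is Lipschitz in the pilot errors (`opNorm_bias_le`). As `∑ t^(-1/2)` is of order `√T`, the scaled
bias is of order `exp(-c κ η T / 2) + η √T + 1/√T` (`integral_biasBound_le`).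

(D1) speaks of prices and demands that are functions of the context, whereas the actual ones are
random. `le_integral_compProd_of_forall_section` bridges this by writing random choices as mixtures
of deterministic ones. -/

namespace DynamicPricing

/-! ### Smallest eigenvalues and quadratic forms -/

/-- `A - κ` is positive semidefinite exactly if the spectrum of `A` is bounded below by `κ`. -/
lemma posSemidef_sub_iff {d : ℕ} {A : Matrix (Fin d) (Fin d) ℝ} (hA : A.IsHermitian) (κ : ℝ) :
    (A - algebraMap ℝ _ κ).PosSemidef ↔ ∀ r ∈ spectrum ℝ A, κ ≤ r := by
  have hκ : (algebraMap ℝ (Matrix (Fin d) (Fin d) ℝ) κ).IsHermitian := by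
    rw [Matrix.algebraMap_eq_diagonal]
    exact Matrix.isHermitian_diagonal _
  rw [Matrix.posSemidef_iff_isHermitian_and_spectrum_nonneg, ← spectrum.sub_singleton_eq]
  constructor
  · rintro ⟨-, h⟩ r hr
    have := h (Set.sub_mem_sub hr (Set.mem_singleton κ))
    simpa using this
  · intro h
    refine ⟨hA.sub hκ, ?_⟩
    rintro _ ⟨r, hr, s, hs, rfl⟩
    rw [Set.mem_singleton_iff] at hs
    subst hs
    simpa using h r hr

lemma dotProduct_sub_algebraMap {d : ℕ} (A : Matrix (Fin d) (Fin d) ℝ) (κ : ℝ) (v : Fin d → ℝ) :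
    v ⬝ᵥ (A - algebraMap ℝ (Matrix (Fin d) (Fin d) ℝ) κ).mulVec v
      = v ⬝ᵥ A.mulVec v - κ * ∑ i, v i ^ 2 := by
  rw [Matrix.sub_mulVec, dotProduct_sub, Algebra.algebraMap_eq_smul_one, Matrix.smul_mulVec,
    Matrix.one_mulVec, dotProduct_smul, smul_eq_mul]
  simp [dotProduct, sq]

lemma quadForm_ge_of_le_lamMin {d : ℕ} {A : Matrix (Fin d) (Fin d) ℝ} (hA : A.IsHermitian)
    {κ : ℝ} (h : κ ≤ lamMin A) (v : Fin d → ℝ) :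
    κ * ∑ i, v i ^ 2 ≤ v ⬝ᵥ A.mulVec v := by
  have hb : BddBelow (spectrum ℝ A) := (Matrix.finite_real_spectrum (A := A)).bddBelow
  have hp := (posSemidef_sub_iff hA κ).2 fun r hr => h.trans (csInf_le hb hr)
  have := hp.dotProduct_mulVec_nonneg v
  rw [star_trivial, dotProduct_sub_algebraMap] at this
  linarith

lemma le_lamMin_of_quadForm_ge {d : ℕ} (hd : 0 < d) {A : Matrix (Fin d) (Fin d) ℝ}
    (hA : A.IsHermitian) {κ : ℝ}
    (h : ∀ v : Fin d → ℝ, κ * ∑ i, v i ^ 2 ≤ v ⬝ᵥ A.mulVec v) : κ ≤ lamMin A := by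
  -- For `d = 0` the spectrum is empty and `sInf ∅ = 0`, so the conclusion could fail for `κ > 0`.
  have : Nonempty (Fin d) := ⟨⟨0, hd⟩⟩
  have hκ : (algebraMap ℝ (Matrix (Fin d) (Fin d) ℝ) κ).IsHermitian := by
    rw [Matrix.algebraMap_eq_diagonal]
    exact Matrix.isHermitian_diagonal _
  have hne : (spectrum ℝ A).Nonempty := by
    rw [hA.spectrum_real_eq_range_eigenvalues]
    exact Set.range_nonempty _
  refine le_csInf hne ((posSemidef_sub_iff hA κ).1 ?_)
  refine Matrix.PosSemidef.of_dotProduct_mulVec_nonneg (hA.sub hκ) fun v => ?_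
  rw [star_trivial, dotProduct_sub_algebraMap]
  linarith [h v]

/-! ### Operator and Frobenius norms -/

/-- The square of the Frobenius norm. -/
noncomputable def frob {d : ℕ} (A : Matrix (Fin d) (Fin d) ℝ) : ℝ := ∑ i, ∑ j, A i j ^ 2

lemma frob_nonneg {d : ℕ} (A : Matrix (Fin d) (Fin d) ℝ) : 0 ≤ frob A := by
  unfold frob; positivity

lemma frob_one (d : ℕ) : frob (1 : Matrix (Fin d) (Fin d) ℝ) = d := by
  simp [frob, Matrix.one_apply]

lemma mulVecE_apply {d : ℕ} (A : Matrix (Fin d) (Fin d) ℝ) (u : Vec d) (i : Fin d) :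
    mulVecE A u i = ∑ j, A i j * u j := rfl

lemma norm_sq_eq_sum {d : ℕ} (u : Vec d) : ‖u‖ ^ 2 = ∑ i, u i ^ 2 := by
  simp [EuclideanSpace.norm_sq_eq]

lemma norm_mulVecE_sq_le {d : ℕ} (A : Matrix (Fin d) (Fin d) ℝ) (u : Vec d) :
    ‖mulVecE A u‖ ^ 2 ≤ frob A * ‖u‖ ^ 2 := by
  rw [norm_sq_eq_sum, norm_sq_eq_sum, frob, Finset.sum_mul]
  refine Finset.sum_le_sum fun i _ => ?_
  rw [mulVecE_apply]
  exact Finset.sum_mul_sq_le_sq_mul_sq _ _ _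

lemma norm_mulVecE_le {d : ℕ} (A : Matrix (Fin d) (Fin d) ℝ) (u : Vec d) :
    ‖mulVecE A u‖ ≤ √(frob A) * ‖u‖ := by
  refine (pow_le_pow_iff_left₀ (norm_nonneg _) (by positivity) two_ne_zero).1 ?_
  rw [mul_pow, Real.sq_sqrt (frob_nonneg A)]
  exact norm_mulVecE_sq_le A u

lemma opNorm_le_sqrt_frob {d : ℕ} (A : Matrix (Fin d) (Fin d) ℝ) : opNorm A ≤ √(frob A) :=
  ContinuousLinearMap.opNorm_le_bound _ (Real.sqrt_nonneg _) (norm_mulVecE_le A)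

lemma opNorm_nonneg {d : ℕ} (A : Matrix (Fin d) (Fin d) ℝ) : 0 ≤ opNorm A := norm_nonneg _

lemma opNorm_add_le {d : ℕ} (A B : Matrix (Fin d) (Fin d) ℝ) :
    opNorm (A + B) ≤ opNorm A + opNorm B := by
  unfold opNorm
  rw [map_add]
  exact norm_add_le _ _

lemma opNorm_sum_le {d : ℕ} {ι : Type*} (s : Finset ι) (A : ι → Matrix (Fin d) (Fin d) ℝ) :
    opNorm (∑ i ∈ s, A i) ≤ ∑ i ∈ s, opNorm (A i) := by
  unfold opNorm
  rw [map_sum]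
  exact norm_sum_le _ _

lemma opNorm_vecMulVec_le {d : ℕ} (w u : Vec d) :
    opNorm (Matrix.vecMulVec w u) ≤ ‖w‖ * ‖u‖ := by
  refine (opNorm_le_sqrt_frob _).trans_eq ?_
  rw [← Real.sqrt_sq (by positivity : 0 ≤ ‖w‖ * ‖u‖), mul_pow, norm_sq_eq_sum, norm_sq_eq_sum,
    frob, Finset.sum_mul_sum]
  simp [Matrix.vecMulVec_apply, mul_pow]

/-! ### The whitening recursion -/

/-- The absolute value covers the finitely many horizons at which `η` may be nonpositive;
integrability of the cubed norms is claimed for every horizon. -/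
lemma norm_whitenColumn_le {d : ℕ} (η : ℝ) (Z : Matrix (Fin d) (Fin d) ℝ) (u : Vec d) :
    ‖whitenColumn η Z u‖ ≤ |η| := by
  unfold whitenColumn
  simp only
  split_ifs with h
  · rw [norm_smul, norm_div, norm_norm, Real.norm_eq_abs]
    rcases eq_or_ne ‖(‖u‖ ^ 2)⁻¹ • mulVecE Z u‖ 0 with h0 | h0
    · rw [h0]; simp
    · rw [div_mul_cancel₀ _ h0]
  · exact (not_le.1 h).le.trans (le_abs_self η)

/-- The new column is a multiple `a • Z u`, where `a` is at most `‖u‖⁻²` and not too small. -/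
lemma whitenColumn_eq_smul {d : ℕ} {η γ B : ℝ} (hη : 0 < η) (Z : Matrix (Fin d) (Fin d) ℝ)
    (u : Vec d) (hu : ‖u‖ ≤ B) (hγB : γ * B ^ 2 ≤ 1) (hγ0 : 0 ≤ γ)
    (hγη : γ * ‖mulVecE Z u‖ ≤ η) :
    ∃ a : ℝ, whitenColumn η Z u = a • mulVecE Z u ∧ 0 ≤ a ∧ a * ‖u‖ ^ 2 ≤ 1 ∧
      γ * ‖mulVecE Z u‖ ^ 2 ≤ a * ‖mulVecE Z u‖ ^ 2 := by
  set z := mulVecE Z u with hz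
  rcases eq_or_ne z 0 with h0 | h0
  · refine ⟨0, ?_, le_rfl, by simp, by simp [h0]⟩
    unfold whitenColumn
    simp [← hz, h0]
  have hu0 : u ≠ 0 := by
    rintro rfl
    exact h0 (by rw [hz]; exact map_zero _)
  have hun : 0 < ‖u‖ := norm_pos_iff.2 hu0
  have hzn : 0 < ‖z‖ := norm_pos_iff.2 h0
  have hw : ‖(‖u‖ ^ 2)⁻¹ • z‖ = ‖z‖ / ‖u‖ ^ 2 := by
    rw [norm_smul, norm_inv, norm_pow, norm_norm]; field_simp
  -- With truncation `a = η / ‖z‖`, which is at least `γ` because `γ ‖z‖ ≤ η`; without it `a =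
  -- ‖u‖⁻²`, which is at least `γ` because `γ B² ≤ 1`.
  by_cases h : η ≤ ‖(‖u‖ ^ 2)⁻¹ • z‖
  · refine ⟨η / ‖z‖, ?_, by positivity, ?_, ?_⟩
    · unfold whitenColumn
      simp only [← hz, if_pos h]
      rw [hw, smul_smul]
      congr 1
      field_simp
    · rw [hw, le_div_iff₀ (by positivity)] at h
      rw [div_mul_eq_mul_div, div_le_one hzn]
      exact h
    · have : η / ‖z‖ * ‖z‖ ^ 2 = η * ‖z‖ := by field_simp
      rw [this]
      nlinarith
  · refine ⟨(‖u‖ ^ 2)⁻¹, ?_, by positivity, ?_, ?_⟩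
    · unfold whitenColumn
      simp only [← hz, if_neg h]
    · rw [inv_mul_cancel₀ (by positivity)]
    · refine mul_le_mul_of_nonneg_right ?_ (by positivity)
      rw [← one_div, le_div_iff₀ (by positivity)]
      exact (mul_le_mul_of_nonneg_left (pow_le_pow_left₀ hun.le hu 2) hγ0).trans hγB

lemma frob_sub_vecMulVec {d : ℕ} (Z : Matrix (Fin d) (Fin d) ℝ) (u : Vec d) (a : ℝ) :
    frob (Z - Matrix.vecMulVec (a • mulVecE Z u : Vec d) u)
      = frob Z - 2 * a * ‖mulVecE Z u‖ ^ 2 + a ^ 2 * ‖mulVecE Z u‖ ^ 2 * ‖u‖ ^ 2 := by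
  have h : ∀ i, ∑ j, (Z - Matrix.vecMulVec (a • mulVecE Z u : Vec d) u) i j ^ 2
      = ∑ j, Z i j ^ 2 - 2 * a * mulVecE Z u i ^ 2
        + a ^ 2 * mulVecE Z u i ^ 2 * ‖u‖ ^ 2 := by
    intro i
    have h1 : ∀ j, (Z - Matrix.vecMulVec (a • mulVecE Z u : Vec d) u) i j ^ 2
        = Z i j ^ 2 - 2 * a * mulVecE Z u i * (Z i j * u j)
          + a ^ 2 * mulVecE Z u i ^ 2 * u j ^ 2 := by
      intro j
      simp only [Matrix.sub_apply, Matrix.vecMulVec_apply, PiLp.smul_apply, smul_eq_mul]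
      ring
    simp_rw [h1]
    rw [Finset.sum_add_distrib, Finset.sum_sub_distrib, ← Finset.mul_sum, ← Finset.mul_sum,
      ← mulVecE_apply, ← norm_sq_eq_sum]
    ring
  unfold frob
  simp_rw [h]
  rw [Finset.sum_add_distrib, Finset.sum_sub_distrib, ← Finset.mul_sum, ← Finset.sum_mul,
    ← Finset.mul_sum, ← norm_sq_eq_sum]

/-- As `a ‖u‖² ≤ 1`, the quadratic term `a² ‖Zu‖² ‖u‖²` eats at most half of the linear gain `2 a
‖Zu‖²`; the other half is at least `γ ‖Zu‖²`. -/
lemma frob_whiten_step {d : ℕ} {η γ B : ℝ} (hη : 0 < η) (Z : Matrix (Fin d) (Fin d) ℝ)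
    (u : Vec d) (hu : ‖u‖ ≤ B) (hγB : γ * B ^ 2 ≤ 1) (hγ0 : 0 ≤ γ)
    (hγη : γ * ‖mulVecE Z u‖ ≤ η) :
    frob (Z - Matrix.vecMulVec (whitenColumn η Z u) u) ≤ frob Z - γ * ‖mulVecE Z u‖ ^ 2 := by
  obtain ⟨a, ha, ha0, ha1, ha2⟩ := whitenColumn_eq_smul hη Z u hu hγB hγ0 hγη
  rw [ha, frob_sub_vecMulVec]
  nlinarith [mul_nonneg (mul_nonneg ha0 (sq_nonneg ‖mulVecE Z u‖)) (sub_nonneg.2 ha1)]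

lemma whitenRemainder_eq {d : ℕ} (η : ℝ) (u : ℕ → Vec d) (t : ℕ) :
    whitenRemainder η u t = 1 - ∑ s ∈ Finset.range t,
      Matrix.vecMulVec (whitenColumn η (whitenRemainder η u s) (u s)) (u s) := by
  induction t with
  | zero => simp [whitenRemainder]
  | succ t ih => rw [Finset.sum_range_succ, ← sub_sub, ← ih]; rfl

lemma frob_whitenRemainder_le {d : ℕ} {η : ℝ} (hη : 0 < η) (u : ℕ → Vec d) (t : ℕ) :
    frob (whitenRemainder η u t) ≤ d := by
  induction t with
  | zero => exact (frob_one d).le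
  | succ t ih =>
    refine le_trans ?_ ih
    -- Taking `γ = 0` gives plain monotonicity, with no condition on the sizes of `η > 0` and of the
    -- gradients.
    have := frob_whiten_step (γ := 0) (B := ‖u t‖) hη (whitenRemainder η u t) (u t) le_rfl
      (by simp) le_rfl (by simpa using hη.le)
    rw [zero_mul, sub_zero] at this
    exact this

/-- Here `γ = c η`. The condition `γ ‖Zu‖ ≤ η` reduces to `c ‖Zu‖ ≤ 1`, and `‖Zu‖ ≤ √d B` because
the remainder never exceeds its initial Frobenius norm `√d`. -/
lemma frob_whitenRemainder_succ_le {d : ℕ} {η c B : ℝ} (hη : 0 < η) (u : ℕ → Vec d) (t : ℕ)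
    (hu : ‖u t‖ ≤ B) (hc : 0 ≤ c) (hcB : c * η * B ^ 2 ≤ 1) (hcd : c * (√d * B) ≤ 1) :
    frob (whitenRemainder η u (t + 1)) ≤
      frob (whitenRemainder η u t) - c * η * ‖mulVecE (whitenRemainder η u t) (u t)‖ ^ 2 := by
  refine frob_whiten_step hη _ _ hu hcB (by positivity) ?_
  have h1 : ‖mulVecE (whitenRemainder η u t) (u t)‖ ≤ √d * B :=
    (norm_mulVecE_le _ _).trans (mul_le_mul (Real.sqrt_le_sqrt (frob_whitenRemainder_le hη u t)) hu
      (norm_nonneg _) (Real.sqrt_nonneg _))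
  have h2 := (mul_le_mul_of_nonneg_left h1 hc).trans hcd
  nlinarith

/-- If the remainder is small, then the columns `w_t` span all directions. -/
lemma sum_inner_sq_ge {d T : ℕ} {B : ℝ} (w u : ℕ → Vec d) (hu : ∀ t < T, ‖u t‖ ≤ B)
    (hZ : frob (1 - ∑ s ∈ Finset.range T, Matrix.vecMulVec (w s) (u s)) ≤ 1 / 4) (v : Vec d) :
    ‖v‖ ^ 2 ≤ 4 * B ^ 2 * T * ∑ t ∈ Finset.range T, (∑ i, v i * w t i) ^ 2 := by
  set Z : Matrix (Fin d) (Fin d) ℝ := 1 - ∑ s ∈ Finset.range T, Matrix.vecMulVec (w s) (u s)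
    with hZdef
  -- This is `⟨v, Z v⟩` with `Z` expanded. Since `‖Z‖ ≤ 1/2` in Frobenius norm, at least half of
  -- `‖v‖²` must come from the sum, to which Cauchy-Schwarz applies.
  have key : ‖v‖ ^ 2 - ∑ t ∈ Finset.range T, (∑ i, v i * w t i) * (∑ i, u t i * v i)
      = ∑ i, v i * mulVecE Z v i := by
    have h1 : ∀ i, mulVecE Z v i = v i - ∑ t ∈ Finset.range T, w t i * ∑ j, u t j * v j := by
      intro i
      rw [mulVecE_apply]
      simp only [hZdef, Matrix.sub_apply, Matrix.sum_apply, Matrix.vecMulVec_apply, sub_mul,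
        Finset.sum_sub_distrib, Matrix.one_apply]
      congr 1
      · simp
      · simp_rw [Finset.sum_mul, Finset.mul_sum]
        rw [Finset.sum_comm]
        simp_rw [mul_assoc]
    simp_rw [h1, mul_sub, Finset.sum_sub_distrib, norm_sq_eq_sum, sq]
    congr 1
    simp_rw [Finset.mul_sum (Finset.range T), Finset.sum_mul]
    rw [Finset.sum_comm]
    simp_rw [mul_assoc]
  have hle : ∑ i, v i * mulVecE Z v i ≤ ‖v‖ ^ 2 / 2 := by
    have h1 : (∑ i, v i * mulVecE Z v i) ^ 2 ≤ ‖v‖ ^ 2 * ‖mulVecE Z v‖ ^ 2 := by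
      rw [norm_sq_eq_sum, norm_sq_eq_sum]
      exact Finset.sum_mul_sq_le_sq_mul_sq _ _ _
    have h2 := norm_mulVecE_sq_le Z v
    refine le_of_abs_le (abs_le_of_sq_le_sq (h1.trans ?_) (by positivity))
    nlinarith [mul_le_mul_of_nonneg_right hZ (sq_nonneg ‖v‖), sq_nonneg ‖v‖]
  have hcs := Finset.sum_mul_sq_le_sq_mul_sq (Finset.range T) (fun t => ∑ i, v i * w t i)
    (fun t => ∑ i, u t i * v i)
  have hub : ∑ t ∈ Finset.range T, (∑ i, u t i * v i) ^ 2 ≤ T * (B ^ 2 * ‖v‖ ^ 2) := by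
    rw [← nsmul_eq_mul]
    nth_rewrite 2 [← Finset.card_range T]
    refine Finset.sum_le_card_nsmul _ _ _ fun t ht => ?_
    have h1 : (∑ i, u t i * v i) ^ 2 ≤ ‖u t‖ ^ 2 * ‖v‖ ^ 2 := by
      rw [norm_sq_eq_sum, norm_sq_eq_sum]
      exact Finset.sum_mul_sq_le_sq_mul_sq _ _ _
    refine h1.trans ?_
    gcongr
    exact hu t (Finset.mem_range.1 ht)
  set q := ∑ t ∈ Finset.range T, (∑ i, v i * w t i) ^ 2
  have hq : 0 ≤ q := by positivity
  have hS : ‖v‖ ^ 2 / 2 ≤ ∑ t ∈ Finset.range T, (∑ i, v i * w t i) * (∑ i, u t i * v i) := by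
    linarith
  have hmain : (‖v‖ ^ 2 / 2) ^ 2 ≤ q * (T * (B ^ 2 * ‖v‖ ^ 2)) :=
    (pow_le_pow_left₀ (by positivity) hS 2).trans (hcs.trans (mul_le_mul_of_nonneg_left hub hq))
  rcases eq_or_ne v 0 with rfl | hv
  · rw [norm_zero, zero_pow two_ne_zero]; positivity
  · have hvn : 0 < ‖v‖ ^ 2 := by positivity
    nlinarith

/-! ### Conditional laws -/

lemma _root_.ProbabilityTheory.HasCondDistrib.prodMk {Ω 𝓧 𝓨 𝓩 : Type*} {mΩ : MeasurableSpace Ω}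
    {m𝓧 : MeasurableSpace 𝓧} {m𝓨 : MeasurableSpace 𝓨} {m𝓩 : MeasurableSpace 𝓩}
    {P : Measure Ω} [SFinite P] {X : Ω → 𝓧} {Y : Ω → 𝓨} {Z : Ω → 𝓩} {κ : Kernel 𝓧 𝓨}
    {η : Kernel (𝓧 × 𝓨) 𝓩} [IsSFiniteKernel κ] [IsSFiniteKernel η] (hY : HasCondDistrib Y X κ P)
    (hZ : HasCondDistrib Z (fun a => (X a, Y a)) η P) :
    HasCondDistrib (fun a => (Y a, Z a)) X (κ ⊗ₖ η) P := by
  have mX : AEMeasurable X P := hY.aemeasurable_fst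
  have mY : AEMeasurable Y P := hY.aemeasurable_snd
  have mZ : AEMeasurable Z P := hZ.aemeasurable_snd
  refine ⟨by fun_prop, ?_⟩
  rw [← Measure.compProd_assoc', ← hY.map_eq, ← hZ.map_eq,
    AEMeasurable.map_map_of_aemeasurable (by fun_prop) (by fun_prop)]
  rfl

/-- The tower property in kernel form. All conditioning on the past goes through it, with integrals
against kernels in the role of conditional expectations. -/
lemma _root_.ProbabilityTheory.HasCondDistrib.integral_comp {Ω 𝓧 𝓨 : Type*}
    {mΩ : MeasurableSpace Ω} {m𝓧 : MeasurableSpace 𝓧} {m𝓨 : MeasurableSpace 𝓨}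
    {P : Measure Ω} [IsFiniteMeasure P] {X : Ω → 𝓧} {Y : Ω → 𝓨} {κ : Kernel 𝓧 𝓨}
    [IsMarkovKernel κ] (h : HasCondDistrib Y X κ P) {φ : 𝓧 × 𝓨 → ℝ} (hφ : Measurable φ)
    (hi : Integrable (fun ω => φ (X ω, Y ω)) P) :
    Integrable (fun ω => ∫ y, φ (X ω, y) ∂(κ (X ω))) P ∧
      ∫ ω, φ (X ω, Y ω) ∂P = ∫ ω, ∫ y, φ (X ω, y) ∂(κ (X ω)) ∂P := by
  have mX := h.aemeasurable_fst
  have mY := h.aemeasurable_snd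
  have mXY : AEMeasurable (fun ω => (X ω, Y ω)) P := by fun_prop
  have h1 : Integrable φ (P.map X ⊗ₘ κ) := by
    rw [← h.map_eq, integrable_map_measure hφ.aestronglyMeasurable mXY]
    exact hi
  have h2 : StronglyMeasurable fun x => ∫ y, φ (x, y) ∂(κ x) :=
    hφ.stronglyMeasurable.integral_kernel_prod_right'
  constructor
  · have : Integrable (fun x => ∫ y, φ (x, y) ∂(κ x)) (P.map X) := by
      simpa using Integrable.integral_compProd (κ := Kernel.const Unit (P.map X))
        (η := Kernel.prodMkLeft Unit κ) (a := ()) h1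
    rwa [integrable_map_measure h2.aestronglyMeasurable mX] at this
  · rw [← integral_map mXY hφ.aestronglyMeasurable, h.map_eq, Measure.integral_compProd h1,
      integral_map mX h2.aestronglyMeasurable]

lemma _root_.ProbabilityTheory.HasCondDistrib.ae_mem {Ω 𝓧 𝓨 : Type*}
    {mΩ : MeasurableSpace Ω} {m𝓧 : MeasurableSpace 𝓧} {m𝓨 : MeasurableSpace 𝓨}
    {P : Measure Ω} [IsFiniteMeasure P] {X : Ω → 𝓧} {Y : Ω → 𝓨} {κ : Kernel 𝓧 𝓨}
    [IsMarkovKernel κ] (h : HasCondDistrib Y X κ P) {s : Set 𝓨} (hs : MeasurableSet s)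
    (hY : ∀ ω, Y ω ∈ s) : ∀ᵐ ω ∂P, ∀ᵐ y ∂(κ (X ω)), y ∈ s := by
  have mX := h.aemeasurable_fst
  have mY := h.aemeasurable_snd
  have mXY : AEMeasurable (fun ω => (X ω, Y ω)) P := by fun_prop
  have h1 : ∀ᵐ q ∂(P.map X ⊗ₘ κ), q.2 ∈ s := by
    rw [← h.map_eq, ae_map_iff mXY (measurable_snd hs)]
    exact ae_of_all _ hY
  exact ae_of_ae_map mX (Measure.ae_ae_of_ae_compProd h1)

/-- A bound that holds for every choice of `y` as a function of `x` with values in `s` also holds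
for every random choice of `y` in `s` given `x`. -/
lemma le_integral_compProd_of_forall_section {𝓧 𝓨 : Type*} [MeasurableSpace 𝓧]
    [MeasurableSpace 𝓨] [StandardBorelSpace 𝓨] {ν : Measure 𝓧} [IsProbabilityMeasure ν]
    {Q : Kernel 𝓧 𝓨} [IsMarkovKernel Q] {s : Set 𝓨} (hs : MeasurableSet s) (hne : s.Nonempty)
    (hQ : ∀ᵐ x ∂ν, ∀ᵐ y ∂(Q x), y ∈ s) {Ψ : 𝓧 × 𝓨 → ℝ} (hΨ : Measurable Ψ) {b : ℝ}
    (hb : ∀ q, |Ψ q| ≤ b) {c : ℝ}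
    (hc : ∀ g : 𝓧 → 𝓨, Measurable g → (∀ x, g x ∈ s) → c ≤ ∫ x, Ψ (x, g x) ∂ν) :
    c ≤ ∫ q, Ψ q ∂(ν ⊗ₘ Q) := by
  classical
  obtain ⟨y₀, hy₀⟩ := hne
  have : Nonempty 𝓨 := ⟨y₀⟩
  -- The kernel is simulated by a uniform seed `u`. For fixed `u` the map `x ↦ g x u` is a
  -- deterministic choice, to which `hc` applies once values outside `s` are redirected to `y₀`;
  -- Fubini then averages over `u`.
  obtain ⟨g, hg, hgQ⟩ := Kernel.exists_measurable_map_eq_unitInterval Q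
  set g' : 𝓧 → unitInterval → 𝓨 := fun x u => if g x u ∈ s then g x u else y₀ with hg'
  have mg' : Measurable (Function.uncurry g') := Measurable.ite (hg hs) hg measurable_const
  have mgx : ∀ x, Measurable (g x) := fun x => hg.of_uncurry_left
  have hint : ∀ (P : Measure (𝓧 × 𝓨)) [IsFiniteMeasure P], Integrable Ψ P := fun P _ =>
    Integrable.of_bound hΨ.aestronglyMeasurable b (ae_of_all _ hb)
  rw [Measure.integral_compProd (hint _)]
  have h1 : ∫ x, ∫ y, Ψ (x, y) ∂(Q x) ∂ν = ∫ x, ∫ u : unitInterval, Ψ (x, g' x u) ∂volume ∂ν := by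
    refine integral_congr_ae ?_
    filter_upwards [hQ] with x hx
    rw [← hgQ x] at hx ⊢
    have hm : Measurable fun y => Ψ (x, y) := hΨ.comp measurable_prodMk_left
    rw [integral_map (mgx x).aemeasurable hm.aestronglyMeasurable]
    refine integral_congr_ae ?_
    filter_upwards [ae_of_ae_map (mgx x).aemeasurable hx] with u hu
    simp only [hg', if_pos hu]
  have m2 : Measurable fun q : 𝓧 × unitInterval => Ψ (q.1, g' q.1 q.2) :=
    hΨ.comp (measurable_fst.prodMk mg')
  have hint2 : Integrable (fun q : 𝓧 × unitInterval => Ψ (q.1, g' q.1 q.2)) (ν.prod volume) :=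
    Integrable.of_bound m2.aestronglyMeasurable b (ae_of_all _ fun _ => hb _)
  rw [h1, integral_integral_swap hint2]
  calc c = ∫ _ : unitInterval, c := by simp
    _ ≤ _ := by
      refine integral_mono (integrable_const _) hint2.integral_prod_right fun u => ?_
      refine hc _ (mg'.comp (measurable_id.prodMk measurable_const)) fun x => ?_
      simp only [hg']
      split_ifs with h
      exacts [h, hy₀]

/-- The sum of uncorrelated uniformly bounded variables. -/
lemma integral_sum_sq_le {Ω : Type*} [MeasurableSpace Ω] {μ : Measure Ω} [IsProbabilityMeasure μ]
    {X : ℕ → Ω → ℝ} {n : ℕ} {b : ℝ} (hX : ∀ t < n, Measurable (X t))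
    (hb : ∀ t < n, ∀ ω, |X t ω| ≤ b) (h0 : ∀ t < n, ∀ s < t, ∫ ω, X s ω * X t ω ∂μ = 0) :
    Integrable (fun ω => (∑ t ∈ Finset.range n, X t ω) ^ 2) μ ∧
      ∫ ω, (∑ t ∈ Finset.range n, X t ω) ^ 2 ∂μ ≤ n * b ^ 2 := by
  have hint : ∀ s < n, ∀ t < n, Integrable (fun ω => X s ω * X t ω) μ := fun s hs t ht =>
    Integrable.of_bound ((hX s hs).mul (hX t ht)).aestronglyMeasurable (b * b)
      (ae_of_all _ fun ω => by
        rw [Real.norm_eq_abs, abs_mul]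
        exact mul_le_mul (hb s hs ω) (hb t ht ω) (abs_nonneg _) ((abs_nonneg _).trans (hb s hs ω)))
  have main : ∀ m ≤ n, Integrable (fun ω => (∑ t ∈ Finset.range m, X t ω) ^ 2) μ ∧
      ∫ ω, (∑ t ∈ Finset.range m, X t ω) ^ 2 ∂μ ≤ m * b ^ 2 := by
    intro m
    induction m with
    | zero => intro; simp
    | succ m ih =>
      intro hm
      obtain ⟨i1, i2⟩ := ih (by omega)
      have e : (fun ω => (∑ t ∈ Finset.range (m + 1), X t ω) ^ 2) = fun ω =>
          (∑ t ∈ Finset.range m, X t ω) ^ 2 + 2 * (∑ t ∈ Finset.range m, X t ω * X m ω)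
            + X m ω * X m ω := by
        ext ω
        rw [Finset.sum_range_succ, ← Finset.sum_mul]
        ring
      have j2 : Integrable (fun ω => ∑ t ∈ Finset.range m, X t ω * X m ω) μ :=
        integrable_finsetSum _ fun t ht => hint t (by have := Finset.mem_range.1 ht; omega) m hm
      have j3 := hint m hm m hm
      have hz : ∫ ω, ∑ t ∈ Finset.range m, X t ω * X m ω ∂μ = 0 := by
        rw [integral_finsetSum _ fun t ht =>
          hint t (by have := Finset.mem_range.1 ht; omega) m hm]
        exact Finset.sum_eq_zero fun t ht => h0 m hm t (Finset.mem_range.1 ht)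
      have hlast : ∫ ω, X m ω * X m ω ∂μ ≤ b ^ 2 := by
        calc ∫ ω, X m ω * X m ω ∂μ ≤ ∫ _, b ^ 2 ∂μ := by
              refine integral_mono j3 (integrable_const _) fun ω => ?_
              have := pow_le_pow_left₀ (abs_nonneg _) (hb m hm ω) 2
              rw [sq_abs] at this
              simpa [sq] using this
          _ = b ^ 2 := by simp
      rw [e]
      refine ⟨(i1.add (j2.const_mul 2)).add j3, ?_⟩
      have i3 : Integrable (fun ω => (∑ t ∈ Finset.range m, X t ω) ^ 2
          + 2 * (∑ t ∈ Finset.range m, X t ω * X m ω)) μ := i1.add (j2.const_mul 2)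
      rw [integral_add i3 j3, integral_add i1 (j2.const_mul 2),
        integral_const_mul, hz]
      push_cast
      linarith
  exact main n le_rfl

/-! ### Measurability of derivatives with respect to a parameter -/

/-- The upper right derivative in direction `v`. It is jointly measurable, and the directional
derivative where the function is differentiable. -/
noncomputable def dirDeriv {d : ℕ} {α : Type*} (v : Vec d) (g : α → Vec d → ℝ) (a : α)
    (θ : Vec d) : ℝ :=
  limsup (fun n : ℕ => (n : ℝ) * (g a (θ + (n : ℝ)⁻¹ • v) - g a θ)) atTop

lemma measurable_dirDeriv {d : ℕ} {α : Type*} [MeasurableSpace α] (v : Vec d)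
    {g : α → Vec d → ℝ} (hg : Measurable fun q : α × Vec d => g q.1 q.2) :
    Measurable fun q : α × Vec d => dirDeriv v g q.1 q.2 := by
  refine Measurable.limsup fun n => Measurable.const_mul (Measurable.sub ?_ hg) _
  exact hg.comp (measurable_fst.prodMk (measurable_snd.add_const _))

lemma dirDeriv_eq {d : ℕ} {α : Type*} (v : Vec d) {g : α → Vec d → ℝ} {a : α} {θ : Vec d}
    (h : DifferentiableAt ℝ (g a) θ) : dirDeriv v g a θ = fderiv ℝ (g a) θ v := by
  refine Tendsto.limsup_eq ?_
  refine h.hasFDerivAt.lim v (c := fun n : ℕ => (n : ℝ)) ?_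
  simpa using tendsto_natCast_atTop_atTop (R := ℝ)

lemma gradient_apply {d : ℕ} (h : Vec d → ℝ) (θ : Vec d) (i : Fin d) :
    gradient h θ i = fderiv ℝ h θ (EuclideanSpace.single i 1) := by
  have h1 := InnerProductSpace.toDual_symm_apply (𝕜 := ℝ) (x := EuclideanSpace.single i (1 : ℝ))
    (y := fderiv ℝ h θ)
  rw [← h1, EuclideanSpace.inner_single_right]
  simp [gradient]

lemma dirDeriv_eq_gradient {d : ℕ} {α : Type*} {g : α → Vec d → ℝ} {a : α} {θ : Vec d}
    (h : ContDiffAt ℝ 1 (g a) θ) (i : Fin d) :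
    dirDeriv (EuclideanSpace.single i 1) g a θ = gradient (g a) θ i := by
  rw [gradient_apply, dirDeriv_eq _ (h.differentiableAt one_ne_zero)]

/-- Being `C²` persists near `θ`, so the inner upper derivative agrees with the true one on a whole
neighbourhood, and the outer one differentiates a genuine partial derivative. -/
lemma dirDeriv_dirDeriv_eq_hessian {d : ℕ} {α : Type*} {g : α → Vec d → ℝ} {a : α} {θ : Vec d}
    (h : ContDiffAt ℝ 2 (g a) θ) (i j : Fin d) :
    dirDeriv (EuclideanSpace.single i 1) (dirDeriv (EuclideanSpace.single j 1) g) a θ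
      = hessian (g a) θ i j := by
  have h1 : DifferentiableAt ℝ (fderiv ℝ (g a)) θ :=
    (h.fderiv_right (m := 1) (by norm_num)).differentiableAt one_ne_zero
  have h2 : dirDeriv (EuclideanSpace.single j 1) g a =ᶠ[𝓝 θ]
      fun θ' => fderiv ℝ (g a) θ' (EuclideanSpace.single j 1) := by
    filter_upwards [h.eventually (by simp)] with θ' hθ'
    exact dirDeriv_eq _ (hθ'.differentiableAt two_ne_zero)
  have h3 : HasFDerivAt (fun θ' => fderiv ℝ (g a) θ' (EuclideanSpace.single j 1))
      ((fderiv ℝ (fderiv ℝ (g a)) θ).flip (EuclideanSpace.single j 1)) θ :=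
    h1.hasFDerivAt.clm_apply (hasFDerivAt_const _ _) |>.congr_fderiv (by ext; simp)
  have h4 := h3.congr_of_eventuallyEq h2
  rw [dirDeriv_eq _ h4.differentiableAt, h4.fderiv]
  simp [hessian, iteratedFDeriv_two_apply]

/-- The Hessian matrix represents the second derivative. -/
lemma quadForm_hessian {d : ℕ} (h : Vec d → ℝ) (θ : Vec d) (v : Vec d) :
    (v : Fin d → ℝ) ⬝ᵥ (hessian h θ).mulVec v = iteratedFDeriv ℝ 2 h θ ![v, v] := by
  have hv : v = ∑ i, v i • EuclideanSpace.single i (1 : ℝ) := by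
    ext k
    simp [Finset.sum_apply, Pi.single_apply]
  conv_rhs => rw [iteratedFDeriv_two_apply]
  simp only [Matrix.cons_val_zero, Matrix.cons_val_one]
  conv_rhs => rw [hv]
  simp only [map_sum, map_smul, sum_apply, smul_apply,
    smul_eq_mul]
  simp only [dotProduct, Matrix.mulVec, hessian, Matrix.of_apply, iteratedFDeriv_two_apply,
    Matrix.cons_val_zero, Matrix.cons_val_one]
  simp only [Finset.mul_sum]
  rw [Finset.sum_comm]
  refine Finset.sum_congr rfl fun i _ => Finset.sum_congr rfl fun j _ => ?_
  ring

lemma hessian_isHermitian {d : ℕ} {h : Vec d → ℝ} {θ : Vec d} (hh : ContDiffAt ℝ 2 h θ)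
    (i j : Fin d) : hessian h θ i j = hessian h θ j i := by
  simp only [hessian, Matrix.of_apply, iteratedFDeriv_two_apply, Matrix.cons_val_zero,
    Matrix.cons_val_one]
  exact (hh.isSymmSndFDerivAt (by simp)) _ _

/-! ### Admissible records and measurable versions of the derivatives. -/

namespace Model

variable {d : ℕ} (M : Model d)

/-- The records whose context, price and demand lie in their ranges. -/
def admissible : Set (Obs d) := {o | o.1 ∈ M.contexts ∧ o.2.1 ∈ M.prices ∧ o.2.2 ∈ M.demands}

lemma measurableSet_admissible (hA1 : M.A1) (hB1 : M.B1) : MeasurableSet M.admissible :=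
  (measurable_fst hA1.contexts_compact.measurableSet).inter
    (((measurable_fst.comp measurable_snd) measurableSet_Icc).inter
      ((measurable_snd.comp measurable_snd) hB1.demands_measurable))

lemma Θ_subset_params : M.Θ ⊆ M.params := subset_convexHull ℝ M.Θ

/-- The triples of a context, a price and a parameter that lie in their ranges. -/
def gradDomain : Set ((Vec d × ℝ) × Vec d) :=
  {q | q.1.1 ∈ M.contexts ∧ q.1.2 ∈ M.prices ∧ q.2 ∈ M.Θ}

/-- The gradient of the demand function, set to zero outside its domain. -/
noncomputable def cutGradF (q : (Vec d × ℝ) × Vec d) : Vec d :=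
  M.gradDomain.indicator (fun q => gradient (M.f q.1.2 q.1.1) q.2) q

lemma cutGradF_eq {x : Vec d} {p : ℝ} {θ : Vec d} (hx : x ∈ M.contexts) (hp : p ∈ M.prices)
    (hθ : θ ∈ M.Θ) : M.cutGradF ((x, p), θ) = gradient (M.f p x) θ :=
  Set.indicator_of_mem (s := M.gradDomain) ⟨hx, hp, hθ⟩ _

lemma measurable_vec {α : Type*} [MeasurableSpace α] {g : α → Vec d}
    (hg : ∀ i, Measurable fun a => g a i) : Measurable g := by
  have h : Measurable fun a => (MeasurableEquiv.toLp 2 (Fin d → ℝ)) (fun i => g a i) :=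
    (MeasurableEquiv.toLp 2 (Fin d → ℝ)).measurable.comp (measurable_pi_lambda _ hg)
  exact h

lemma measurable_vec_apply (i : Fin d) : Measurable fun v : Vec d => v i :=
  (EuclideanSpace.proj (𝕜 := ℝ) i).continuous.measurable

/-- The parameter here is itself random, so joint measurability is needed. On its domain, each
component is a limsup of difference quotients of the jointly measurable `f`. -/
lemma measurable_cutGradF (hA1 : M.A1) (hA2 : M.A2) : Measurable M.cutGradF := by
  have hs : MeasurableSet M.gradDomain :=
    ((measurable_fst.comp measurable_fst) hA1.contexts_compact.measurableSet).inter
      (((measurable_snd.comp measurable_fst) measurableSet_Icc).inter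
        (measurable_snd hA1.params_compact.measurableSet))
  refine measurable_vec fun i => ?_
  have h1 : Measurable fun q : (Vec d × ℝ) × Vec d =>
      dirDeriv (EuclideanSpace.single i 1) (fun a : Vec d × ℝ => M.f a.2 a.1) q.1 q.2 := by
    refine measurable_dirDeriv _ ?_
    exact hA2.measurable.comp (f := fun q : (Vec d × ℝ) × Vec d => (q.1.2, q.1.1, q.2))
      (by fun_prop)
  have h2 := h1.indicator hs
  convert h2 using 1
  ext q
  by_cases hq : q ∈ M.gradDomain
  · rw [cutGradF, Set.indicator_of_mem hq, Set.indicator_of_mem hq]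
    exact (dirDeriv_eq_gradient (g := fun a : Vec d × ℝ => M.f a.2 a.1) (a := q.1)
      (hA2.smooth _ hq.2.1 _ hq.1 _ (M.Θ_subset_params hq.2.2)) i).symm
  · rw [cutGradF, Set.indicator_of_notMem hq, Set.indicator_of_notMem hq]
    rfl

lemma norm_cutGradF_le {B : ℝ} (hB0 : 0 ≤ B) (hB : ∀ p ∈ M.prices, ∀ x ∈ M.contexts,
    ∀ θ ∈ M.params, ‖gradient (M.f p x) θ‖ ≤ B) (q : (Vec d × ℝ) × Vec d) :
    ‖M.cutGradF q‖ ≤ B := by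
  by_cases hq : q ∈ M.gradDomain
  · rw [cutGradF, Set.indicator_of_mem hq]
    exact hB _ hq.2.1 _ hq.1 _ (M.Θ_subset_params hq.2.2)
  · rw [cutGradF, Set.indicator_of_notMem hq, norm_zero]
    exact hB0

/-- A partial derivative of the risk at the true parameter, set to zero off the admissible
records. -/
noncomputable def cutGradRho (i : Fin d) : Obs d → ℝ :=
  M.admissible.indicator fun o => gradient (M.ρ o.2.2 o.2.1 o.1) M.θ₀ i

/-- A second partial derivative of the risk, set to zero off the admissible records. -/
noncomputable def cutHess (θ : Vec d) (i j : Fin d) : Obs d → ℝ :=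
  M.admissible.indicator fun o => hessian (M.ρ o.2.2 o.2.1 o.1) θ i j

lemma measurable_rho (hC1 : M.C1) :
    Measurable fun q : Obs d × Vec d => M.ρ q.1.2.2 q.1.2.1 q.1.1 q.2 :=
  hC1.measurable.comp (f := fun q : Obs d × Vec d => (q.1.2.2, q.1.2.1, q.1.1, q.2)) (by fun_prop)

lemma measurable_cutGradRho (hA1 : M.A1) (hB1 : M.B1) (hC1 : M.C1) (i : Fin d) :
    Measurable (M.cutGradRho i) := by
  have h1 := measurable_dirDeriv (g := fun o : Obs d => M.ρ o.2.2 o.2.1 o.1)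
    (EuclideanSpace.single i 1) (M.measurable_rho hC1)
  have h2 := (h1.comp (measurable_prodMk_right (y := M.θ₀))).indicator (M.measurableSet_admissible hA1 hB1)
  convert h2 using 1
  refine Set.indicator_congr fun o ho => ?_
  exact (dirDeriv_eq_gradient (g := fun o : Obs d => M.ρ o.2.2 o.2.1 o.1) (a := o)
    ((hC1.smooth _ ho.2.2 _ ho.2.1 _ ho.1 _ (M.Θ_subset_params hA1.true_mem)).of_le
      (by norm_num)) i).symm

lemma measurable_cutHess (hA1 : M.A1) (hB1 : M.B1) (hC1 : M.C1) {θ : Vec d} (hθ : θ ∈ M.params)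
    (i j : Fin d) : Measurable (M.cutHess θ i j) := by
  have h1 := measurable_dirDeriv (EuclideanSpace.single i 1)
    (measurable_dirDeriv (g := fun o : Obs d => M.ρ o.2.2 o.2.1 o.1)
      (EuclideanSpace.single j 1) (M.measurable_rho hC1))
  have h2 := (h1.comp (measurable_prodMk_right (y := θ))).indicator (M.measurableSet_admissible hA1 hB1)
  convert h2 using 1
  refine Set.indicator_congr fun o ho => ?_
  exact (dirDeriv_dirDeriv_eq_hessian (g := fun o : Obs d => M.ρ o.2.2 o.2.1 o.1) (a := o)
    ((hC1.smooth _ ho.2.2 _ ho.2.1 _ ho.1 _ hθ).of_le (by norm_num)) i j).symm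

lemma abs_indicator_le {α : Type*} {s : Set α} {g : α → ℝ} {b : ℝ} (hb : 0 ≤ b)
    (h : ∀ a ∈ s, |g a| ≤ b) (a : α) : |s.indicator g a| ≤ b := by
  by_cases ha : a ∈ s
  · rw [Set.indicator_of_mem ha]; exact h a ha
  · rw [Set.indicator_of_notMem ha, abs_zero]; exact hb

/-- `B` bounds the derivatives of the risk up to order three. -/
def RiskBound (B : ℝ) : Prop :=
  ∀ y ∈ M.demands, ∀ p ∈ M.prices, ∀ x ∈ M.contexts, ∀ θ ∈ M.params,
    ∀ k ≤ 3, ‖iteratedFDeriv ℝ k (M.ρ y p x) θ‖ ≤ B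

variable {M}

lemma abs_cutGradRho_le (hA1 : M.A1) {B : ℝ} (hB0 : 0 ≤ B) (hB : M.RiskBound B) (i : Fin d)
    (o : Obs d) : |M.cutGradRho i o| ≤ B := by
  refine abs_indicator_le hB0 (fun o ho => ?_) o
  have h := hB _ ho.2.2 _ ho.2.1 _ ho.1 _ (M.Θ_subset_params hA1.true_mem) 1 (by norm_num)
  rw [norm_iteratedFDeriv_one] at h
  rw [gradient_apply, ← Real.norm_eq_abs]
  refine (ContinuousLinearMap.le_opNorm _ _).trans ?_
  simpa using h

lemma abs_cutHess_le {B : ℝ} (hB0 : 0 ≤ B) (hB : M.RiskBound B) {θ : Vec d} (hθ : θ ∈ M.params)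
    (i j : Fin d) (o : Obs d) : |M.cutHess θ i j o| ≤ B := by
  refine abs_indicator_le hB0 (fun o ho => ?_) o
  have h := hB _ ho.2.2 _ ho.2.1 _ ho.1 _ hθ 2 (by norm_num)
  rw [hessian, Matrix.of_apply, ← Real.norm_eq_abs]
  refine (ContinuousMultilinearMap.le_opNorm _ _).trans ?_
  simpa [Fin.prod_univ_two] using h

end Model

/-! ### The conditional law of one period, and martingale deviations. -/

namespace SalesProcess

variable {d : ℕ} {M : Model d} {T : ℕ} {Ω : Type*} [MeasurableSpace Ω] {μ : Measure Ω}
  (S : SalesProcess M T μ)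

/-- The record of period `t`. -/
def obs (t : ℕ) (ω : Ω) : Obs d := (S.x t ω, S.p t ω, S.y t ω)

/-- The conditional law of price and demand given the past and the context. -/
noncomputable def reaction (t : ℕ) : Kernel ((Fin t → Obs d) × Vec d) (ℝ × ℝ) :=
  S.policy t ⊗ₖ M.law.comap (fun z : ((Fin t → Obs d) × Vec d) × ℝ => (z.2, z.1.2)) (by fun_prop)

/-- The conditional law of the record of period `t` given the past. -/
noncomputable def step (t : ℕ) : Kernel (Fin t → Obs d) (Obs d) := S.context t ⊗ₖ S.reaction t

variable {S}

lemma markov_reaction (hB1 : M.B1) {t : ℕ} (ht : t < T) : IsMarkovKernel (S.reaction t) := by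
  have := hB1.markov
  have := S.policy_markov t ht
  unfold reaction
  infer_instance

lemma markov_step (hB1 : M.B1) {t : ℕ} (ht : t < T) : IsMarkovKernel (S.step t) := by
  have := S.context_markov t ht
  have := markov_reaction (S := S) hB1 ht
  unfold step
  infer_instance

lemma measurable_obs {t : ℕ} (ht : t < T) : Measurable (S.obs t) :=
  (S.x_measurable t ht).prodMk ((S.p_measurable t ht).prodMk (S.y_measurable t ht))

lemma measurable_history {t : ℕ} (ht : t ≤ T) : Measurable (S.history t) :=
  measurable_pi_lambda _ fun s => measurable_obs (S := S) (s.2.trans_le ht)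

lemma obs_mem {t : ℕ} (ht : t < T) (ω : Ω) : S.obs t ω ∈ M.admissible :=
  ⟨S.x_mem t ht ω, S.p_mem t ht ω, S.y_mem t ht ω⟩

lemma integrable_of_abs_le {α : Type*} [MeasurableSpace α] {ν : Measure α} [IsFiniteMeasure ν]
    {g : α → ℝ} (hg : Measurable g) {b : ℝ} (hb : ∀ a, |g a| ≤ b) : Integrable g ν :=
  Integrable.of_bound hg.aestronglyMeasurable b (ae_of_all _ hb)

lemma quadForm_integral {α : Type*} [MeasurableSpace α] {ν : Measure α}
    {A : α → Matrix (Fin d) (Fin d) ℝ} (hA : ∀ i j, Integrable (fun a => A a i j) ν)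
    (v : Fin d → ℝ) :
    v ⬝ᵥ (Matrix.of fun i j => ∫ a, A a i j ∂ν).mulVec v = ∫ a, v ⬝ᵥ (A a).mulVec v ∂ν := by
  simp only [dotProduct, Matrix.mulVec, Matrix.of_apply]
  rw [integral_finsetSum _ fun i _ =>
    (integrable_finsetSum _ fun j _ => (hA i j).mul_const _).const_mul _]
  refine Finset.sum_congr rfl fun i _ => ?_
  rw [integral_const_mul, integral_finsetSum _ fun j _ => (hA i j).mul_const _]
  simp_rw [integral_mul_const]

/-- Row by row, this presents `‖Zu‖²` as a sum of quadratic forms of `u uᵀ`, whose average is what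
(D1) bounds. -/
lemma norm_mulVecE_sq_eq (Z : Matrix (Fin d) (Fin d) ℝ) (u : Vec d) :
    ‖mulVecE Z u‖ ^ 2
      = ∑ k, Z k ⬝ᵥ (Matrix.of fun i j => u i * u j : Matrix (Fin d) (Fin d) ℝ).mulVec (Z k) := by
  rw [norm_sq_eq_sum]
  refine Finset.sum_congr rfl fun k _ => ?_
  rw [mulVecE_apply, sq, Finset.sum_mul_sum]
  simp only [dotProduct, Matrix.mulVec, Matrix.of_apply, Finset.mul_sum]
  refine Finset.sum_congr rfl fun i _ => Finset.sum_congr rfl fun j _ => ?_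
  ring

/-- Given the past, the gradient of the risk at the true parameter is centered. -/
lemma integral_step_cutGradRho (hA1 : M.A1) (hB1 : M.B1) (hC1 : M.C1) (hC2 : M.C2)
    {t : ℕ} (ht : t < T) (h : Fin t → Obs d) (i : Fin d) :
    ∫ o, M.cutGradRho i o ∂(S.step t h) = 0 := by
  have := hB1.markov
  have := S.policy_markov t ht
  have := S.context_markov t ht
  have := markov_reaction (S := S) hB1 ht
  obtain ⟨B₀, hB₀⟩ := hC1.bounded
  set B := max B₀ 0
  have hB0 : 0 ≤ B := le_max_right _ _
  have hB : M.RiskBound B := fun y hy p hp x hx θ hθ k hk =>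
    (hB₀ y hy p hp x hx θ hθ k hk).trans (le_max_left _ _)
  have hm := fun i => M.measurable_cutGradRho hA1 hB1 hC1 i
  have hb := fun i => Model.abs_cutGradRho_le hA1 hB0 hB i
  -- Off the ranges of context and price the cut function vanishes, so the identity holds for every
  -- pair and hence for every history, not just almost every one.
  have inner : ∀ x p, ∫ y, M.cutGradRho i (x, p, y) ∂(M.law (p, x)) = 0 := by
    intro x p
    by_cases hxp : x ∈ M.contexts ∧ p ∈ M.prices
    · have hae : ∀ᵐ y ∂(M.law (p, x)), ∀ j,
          M.cutGradRho j (x, p, y) = gradient (M.ρ y p x) M.θ₀ j := by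
        filter_upwards [hB1.supported p hxp.2 x hxp.1] with y hy j
        exact Set.indicator_of_mem (s := M.admissible) (a := (x, p, y)) ⟨hxp.1, hxp.2, hy⟩ _
      -- Integrability lets the coordinate projection pass through the vector-valued integral in
      -- (C2).
      have hgi : Integrable (fun y => gradient (M.ρ y p x) M.θ₀) (M.law (p, x)) := by
        have hmeas : Measurable fun y =>
            (WithLp.toLp 2 (fun j => M.cutGradRho j (x, p, y)) : Vec d) :=
          Model.measurable_vec fun j =>
            (hm j).comp (measurable_const.prodMk (measurable_const.prodMk measurable_id))
        have hint : Integrable (fun y =>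
            (WithLp.toLp 2 (fun j => M.cutGradRho j (x, p, y)) : Vec d)) (M.law (p, x)) := by
          refine Integrable.of_bound hmeas.aestronglyMeasurable (√(∑ _j : Fin d, B ^ 2))
            (ae_of_all _ fun y => ?_)
          rw [EuclideanSpace.norm_eq]
          refine Real.sqrt_le_sqrt (Finset.sum_le_sum fun j _ => ?_)
          exact pow_le_pow_left₀ (norm_nonneg _) (hb j _) 2
        refine hint.congr ?_
        filter_upwards [hae] with y hy
        ext j
        exact hy j
      have h0 := hC2 p hxp.2 x hxp.1
      have h1 := (EuclideanSpace.proj (𝕜 := ℝ) i).integral_comp_comm hgi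
      rw [h0, map_zero] at h1
      rw [← h1]
      refine integral_congr_ae ?_
      filter_upwards [hae] with y hy
      exact hy i
    · have : ∀ y, M.cutGradRho i (x, p, y) = 0 := fun y =>
        Set.indicator_of_notMem (s := M.admissible) (fun ha => hxp ⟨ha.1, ha.2.1⟩) _
      simp [this]
  have hi : ∀ (ν : Measure (Obs d)) [IsFiniteMeasure ν], Integrable (M.cutGradRho i) ν :=
    fun ν _ => integrable_of_abs_le (hm i) (hb i)
  rw [step, ProbabilityTheory.integral_compProd (hi _)]
  refine integral_eq_zero_of_ae (ae_of_all _ fun x => ?_)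
  simp only [reaction, Pi.zero_apply]
  have hi2 : ∀ (ν : Measure (ℝ × ℝ)) [IsFiniteMeasure ν],
      Integrable (fun z => M.cutGradRho i (x, z)) ν :=
    fun ν _ => integrable_of_abs_le ((hm i).comp measurable_prodMk_left) fun z => hb i _
  rw [ProbabilityTheory.integral_compProd (hi2 _)]
  refine integral_eq_zero_of_ae (ae_of_all _ fun p => ?_)
  simp only [Kernel.comap_apply, Pi.zero_apply]
  exact inner x p

/-- The deviation of a function of the record from its conditional mean. -/
noncomputable def deviation (S : SalesProcess M T μ) (φ : Obs d → ℝ) (t : ℕ) (ω : Ω) : ℝ :=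
  φ (S.obs t ω) - ∫ o, φ o ∂(S.step t (S.history t ω))

lemma measurable_integral_step (hB1 : M.B1) {φ : Obs d → ℝ} (hφ : Measurable φ) {t : ℕ}
    (ht : t < T) : Measurable fun h => ∫ o, φ o ∂(S.step t h) := by
  have := markov_step (S := S) hB1 ht
  exact (StronglyMeasurable.integral_kernel_prod_right' (κ := S.step t)
    (f := fun q : (Fin t → Obs d) × Obs d => φ q.2)
    (hφ.comp measurable_snd).stronglyMeasurable).measurable

variable [IsProbabilityMeasure μ]

lemma hasCondDistrib_obs (hB1 : M.B1) {t : ℕ} (ht : t < T) :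
    HasCondDistrib (S.obs t) (S.history t) (S.step t) μ := by
  have := hB1.markov
  have := S.policy_markov t ht
  have := S.context_markov t ht
  have := markov_reaction (S := S) hB1 ht
  refine (S.context_law t ht).prodMk ?_
  refine (S.policy_law t ht).prodMk ?_
  have h := S.demand_law t ht
  -- `demand_law` conditions on `(history, (x, p))`, the chain rule on `((history, x), p)`; only the
  -- bracketing differs.
  exact HasCondDistrib.comp_right (f := MeasurableEquiv.prodAssoc.symm)
    (hf := MeasurableEquiv.prodAssoc.symm.measurable)
    (κ := M.law.comap (fun z : ((Fin t → Obs d) × Vec d) × ℝ => (z.2, z.1.2)) (by fun_prop)) h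

lemma ae_step_mem (hA1 : M.A1) (hB1 : M.B1) {t : ℕ} (ht : t < T) :
    ∀ᵐ ω ∂μ, ∀ᵐ o ∂(S.step t (S.history t ω)), o ∈ M.admissible := by
  have := markov_step (S := S) hB1 ht
  exact (hasCondDistrib_obs hB1 ht).ae_mem (M.measurableSet_admissible hA1 hB1) (obs_mem ht)

lemma ae_context_mem (hA1 : M.A1) {t : ℕ} (ht : t < T) :
    ∀ᵐ ω ∂μ, ∀ᵐ x ∂(S.context t (S.history t ω)), x ∈ M.contexts := by
  have := S.context_markov t ht
  exact (S.context_law t ht).ae_mem hA1.contexts_compact.measurableSet (S.x_mem t ht)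

/-- A bound for all prices and demands chosen as functions of the context carries over to the
conditional law of the record. -/
lemma le_integral_step (hA1 : M.A1) (hB1 : M.B1) {t : ℕ} (ht : t < T) :
    ∀ᵐ ω ∂μ, ∀ (Ψ : Obs d → ℝ) (b c : ℝ), Measurable Ψ → (∀ o, |Ψ o| ≤ b) →
      (∀ pp yy : Vec d → ℝ, Measurable pp → Measurable yy → (∀ x, pp x ∈ M.prices) →
        (∀ x, yy x ∈ M.demands) → c ≤ ∫ x, Ψ (x, pp x, yy x) ∂(S.context t (S.history t ω))) →
      c ≤ ∫ o, Ψ o ∂(S.step t (S.history t ω)) := by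
  have := S.context_markov t ht
  have := markov_reaction (S := S) hB1 ht
  filter_upwards [ae_step_mem (S := S) hA1 hB1 ht] with ω hω Ψ b c hΨ hb hc
  rw [step, Kernel.compProd_apply_eq_compProd_sectR] at hω ⊢
  refine le_integral_compProd_of_forall_section (s := M.prices ×ˢ M.demands)
    (measurableSet_Icc.prod hB1.demands_measurable)
    ⟨(S.p t ω, S.y t ω), S.p_mem t ht ω, S.y_mem t ht ω⟩ ?_ hΨ hb ?_
  · filter_upwards [Measure.ae_ae_of_ae_compProd hω] with x hx
    filter_upwards [hx] with z hz
    exact hz.2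
  · intro g hg hgs
    exact hc (fun x => (g x).1) (fun x => (g x).2) hg.fst hg.snd (fun x => (hgs x).1)
      fun x => (hgs x).2

/-- The conditional second moment of the gradients is nondegenerate. -/
lemma frob_le_integral_step (hA1 : M.A1) (hA2 : M.A2) (hB1 : M.B1) {κ : ℝ} (hD1 : S.D1 κ)
    {t : ℕ} (ht : t < T) :
    ∀ᵐ ω ∂μ, ∀ θ ∈ M.Θ, ∀ Z : Matrix (Fin d) (Fin d) ℝ,
      κ * frob Z ≤ ∫ o : Obs d, ‖mulVecE Z (M.cutGradF ((o.1, o.2.1), θ))‖ ^ 2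
        ∂(S.step t (S.history t ω)) := by
  have := S.context_markov t ht
  obtain ⟨B, hB⟩ := hA2.bounded
  -- The null set is fixed before `θ` and `Z`, since both will later be functions of the history.
  -- Given the history they are constants, so the constant parameter choice in (D1) suffices.
  filter_upwards [le_integral_step (S := S) hA1 hB1 ht, ae_context_mem (S := S) hA1 ht,
    hD1 t ht] with ω h1 h2 h3 θ hθ Z
  have hBb : ∀ q, ‖M.cutGradF q‖ ≤ max B 0 := M.norm_cutGradF_le (le_max_right _ _)
    fun p hp x hx θ hθ => (hB p hp x hx θ hθ).2.trans (le_max_left _ _)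
  have hm := M.measurable_cutGradF hA1 hA2
  have hmv : Measurable fun u : Vec d => ‖mulVecE Z u‖ ^ 2 :=
    ((Matrix.toEuclideanCLM (𝕜 := ℝ) Z).continuous.norm.pow 2).measurable
  refine h1 _ (frob Z * max B 0 ^ 2) _ (hmv.comp (hm.comp (by fun_prop))) (fun o => ?_) ?_
  · rw [abs_of_nonneg (by positivity)]
    exact (norm_mulVecE_sq_le _ _).trans (mul_le_mul_of_nonneg_left
      (pow_le_pow_left₀ (norm_nonneg _) (hBb _) 2) (frob_nonneg Z))
  intro pp yy hpp hyy hppm hyym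
  have hq := (h3 yy pp (fun _ => θ) hyy hpp measurable_const hyym hppm
    fun _ => M.Θ_subset_params hθ).1
  set ν := S.context t (S.history t ω)
  set g : Vec d → Vec d := fun x => M.cutGradF ((x, pp x), θ) with hg
  have mg : Measurable g := hm.comp (by fun_prop)
  have mgi : ∀ i, Measurable fun x => g x i := fun i => (Model.measurable_vec_apply i).comp mg
  have hint : ∀ i j, Integrable (fun x => (Matrix.of fun i j => g x i * g x j :
      Matrix (Fin d) (Fin d) ℝ) i j) ν := by
    intro i j
    refine integrable_of_abs_le (b := max B 0 * max B 0) ((mgi i).mul (mgi j)) fun x => ?_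
    have hb1 : ∀ i, |g x i| ≤ max B 0 := fun i =>
      (PiLp.norm_apply_le (g x) i).trans (hBb _)
    rw [Matrix.of_apply, abs_mul]
    exact mul_le_mul (hb1 i) (hb1 j) (abs_nonneg _) (le_max_right _ _)
  have hEq : (Matrix.of fun i j : Fin d => ∫ x, gradient (M.f (pp x) x) θ i
      * gradient (M.f (pp x) x) θ j ∂ν) = Matrix.of fun i j : Fin d => ∫ x,
        (Matrix.of fun i j => g x i * g x j : Matrix (Fin d) (Fin d) ℝ) i j ∂ν := by
    ext i j
    refine integral_congr_ae ?_
    filter_upwards [h2] with x hx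
    simp only [hg, Matrix.of_apply, M.cutGradF_eq hx (hppm x) hθ]
  rw [hEq] at hq
  have hH : (Matrix.of fun i j : Fin d => ∫ x,
        (Matrix.of fun i j => g x i * g x j : Matrix (Fin d) (Fin d) ℝ) i j ∂ν).IsHermitian := by
    ext i j
    simp [mul_comm]
  simp_rw [norm_mulVecE_sq_eq]
  rw [integral_finsetSum]
  · rw [frob, Finset.mul_sum]
    refine Finset.sum_le_sum fun k _ => ?_
    have := quadForm_ge_of_le_lamMin hH hq (Z k)
    rwa [quadForm_integral hint] at this
  · intro k _
    simp only [dotProduct, Matrix.mulVec]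
    exact integrable_finsetSum _ fun i _ =>
      (integrable_finsetSum _ fun j _ => (hint i j).mul_const _).const_mul _

/-- The conditional mean of the Hessian matrix of the risk is positive definite. -/
lemma quadForm_le_integral_step (hA1 : M.A1) (hB1 : M.B1) (hC1 : M.C1) {κ : ℝ}
    (hD1 : S.D1 κ) {t : ℕ} (ht : t < T) :
    ∀ᵐ ω ∂μ, ∀ θ ∈ M.params, ∀ v : Fin d → ℝ,
      κ * ∑ i, v i ^ 2 ≤ v ⬝ᵥ (Matrix.of fun i j => ∫ o : Obs d, M.cutHess θ i j o
        ∂(S.step t (S.history t ω))).mulVec v := by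
  have := S.context_markov t ht
  have := markov_step (S := S) hB1 ht
  obtain ⟨B₀, hB₀⟩ := hC1.bounded
  set B := max B₀ 0
  have hB0 : 0 ≤ B := le_max_right _ _
  have hB : M.RiskBound B := fun y hy p hp x hx θ hθ k hk =>
    (hB₀ y hy p hp x hx θ hθ k hk).trans (le_max_left _ _)
  filter_upwards [le_integral_step (S := S) hA1 hB1 ht, ae_context_mem (S := S) hA1 ht,
    hD1 t ht] with ω h1 h2 h3 θ hθ v
  have hm := fun i j => M.measurable_cutHess hA1 hB1 hC1 hθ i j
  have hb := fun i j => Model.abs_cutHess_le hB0 hB hθ i j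
  rw [quadForm_integral fun i j => integrable_of_abs_le (hm i j) (hb i j)]
  refine h1 (fun o => v ⬝ᵥ Matrix.mulVec (fun i j => M.cutHess θ i j o) v)
    (∑ i, ∑ j, |v i| * (B * |v j|)) _ ?_ (fun o => ?_) ?_
  · simp only [dotProduct, Matrix.mulVec]
    fun_prop
  · simp only [dotProduct, Matrix.mulVec, Finset.mul_sum]
    refine (Finset.abs_sum_le_sum_abs _ _).trans (Finset.sum_le_sum fun i _ => ?_)
    refine (Finset.abs_sum_le_sum_abs _ _).trans (Finset.sum_le_sum fun j _ => ?_)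
    rw [abs_mul, abs_mul]
    gcongr
    exact hb i j o
  intro pp yy hpp hyy hppm hyym
  have hq := (h3 yy pp (fun _ => θ) hyy hpp measurable_const hyym hppm fun _ => hθ).2
  set ν := S.context t (S.history t ω)
  have hEq : (Matrix.of fun i j : Fin d => ∫ x, hessian (M.ρ (yy x) (pp x) x) θ i j ∂ν)
      = Matrix.of fun i j : Fin d => ∫ x, M.cutHess θ i j (x, pp x, yy x) ∂ν := by
    ext i j
    refine integral_congr_ae ?_
    filter_upwards [h2] with x hx
    exact (Set.indicator_of_mem (show (x, pp x, yy x) ∈ M.admissible from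
      ⟨hx, hppm x, hyym x⟩) fun o : Obs d => hessian (M.ρ o.2.2 o.2.1 o.1) θ i j).symm
  rw [hEq] at hq
  have hH : (Matrix.of fun i j : Fin d =>
      ∫ x, M.cutHess θ i j (x, pp x, yy x) ∂ν).IsHermitian := by
    ext i j
    simp only [Matrix.conjTranspose_apply, Matrix.of_apply, star_trivial]
    have hsymm : M.cutHess θ j i = M.cutHess θ i j := by
      unfold Model.cutHess
      exact Set.indicator_congr fun o ho =>
        hessian_isHermitian ((hC1.smooth _ ho.2.2 _ ho.2.1 _ ho.1 _ hθ).of_le (by norm_num)) _ _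
    rw [hsymm]
  have hint : ∀ i j, Integrable (fun x => (Matrix.of fun i j => M.cutHess θ i j (x, pp x, yy x) :
      Matrix (Fin d) (Fin d) ℝ) i j) ν := fun i j => integrable_of_abs_le
    ((hm i j).comp (measurable_id.prodMk (hpp.prodMk hyy))) fun x => hb i j _
  have := quadForm_ge_of_le_lamMin hH hq v
  have e := quadForm_integral hint v
  exact this.trans_eq e

/-- Deviations from conditional means are martingale differences bounded by `2b`; being
uncorrelated, their sum has a second moment linear in `n`. -/
lemma integral_sum_deviation_sq_le (hB1 : M.B1) {φ : Obs d → ℝ} (hφ : Measurable φ) {b : ℝ}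
    (hb : ∀ o, |φ o| ≤ b) {n : ℕ} (hn : n ≤ T) :
    Integrable (fun ω => (∑ t ∈ Finset.range n, S.deviation φ t ω) ^ 2) μ ∧
      ∫ ω, (∑ t ∈ Finset.range n, S.deviation φ t ω) ^ 2 ∂μ ≤ n * (2 * b) ^ 2 := by
  have hK : ∀ t < T, ∀ h, |∫ o, φ o ∂(S.step t h)| ≤ b := by
    intro t ht h
    have := markov_step (S := S) hB1 ht
    have := norm_integral_le_of_norm_le_const (μ := S.step t h) (ae_of_all _ fun o => (Real.norm_eq_abs _).trans_le (hb o))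
    simpa using this
  have mdev : ∀ t < T, Measurable (S.deviation φ t) := fun t ht =>
    (hφ.comp (measurable_obs ht)).sub
      ((measurable_integral_step hB1 hφ ht).comp (measurable_history ht.le))
  have bdev : ∀ t < T, ∀ ω, |S.deviation φ t ω| ≤ 2 * b := by
    intro t ht ω
    refine (abs_sub _ _).trans ?_
    linarith [hb (S.obs t ω), hK t ht (S.history t ω)]
  refine integral_sum_sq_le (fun t ht => mdev t (ht.trans_le hn))
    (fun t ht => bdev t (ht.trans_le hn)) fun t ht s hs => ?_
  have htT := ht.trans_le hn
  have hsT := hs.trans htT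
  have := markov_step (S := S) hB1 htT
  -- The earlier deviation is a function of the records before `t`, so in the cross term it factors
  -- out of the conditional integral, which is zero.
  set G : (Fin t → Obs d) → ℝ := fun h => φ (h ⟨s, hs⟩)
    - ∫ o, φ o ∂(S.step s fun r => h (Fin.castLE hs.le r)) with hG
  have mG : Measurable G := by
    have m1 : Measurable fun h : Fin t → Obs d => h ⟨s, hs⟩ := measurable_pi_apply _
    have m2 : Measurable fun (h : Fin t → Obs d) (r : Fin s) => h (Fin.castLE hs.le r) :=
      measurable_pi_lambda _ fun r => measurable_pi_apply _
    exact (hφ.comp m1).sub ((measurable_integral_step hB1 hφ hsT).comp m2)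
  have hGe : ∀ ω, S.deviation φ s ω = G (S.history t ω) := fun ω => rfl
  have mint := measurable_integral_step (S := S) hB1 hφ htT
  have key := ((hasCondDistrib_obs (S := S) hB1 htT).integral_comp
    (φ := fun q : (Fin t → Obs d) × Obs d => G q.1 * (φ q.2 - ∫ o, φ o ∂(S.step t q.1)))
    ((mG.comp measurable_fst).mul ((hφ.comp measurable_snd).sub (mint.comp measurable_fst)))
    (integrable_of_abs_le (b := 2 * b * (2 * b)) ?_ ?_)).2
  · calc ∫ ω, S.deviation φ s ω * S.deviation φ t ω ∂μ
        = ∫ ω, G (S.history t ω) * (φ (S.obs t ω)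
            - ∫ o, φ o ∂(S.step t (S.history t ω))) ∂μ := rfl
      _ = _ := key
      _ = 0 := by
        refine integral_eq_zero_of_ae (ae_of_all _ fun ω => ?_)
        simp only [Pi.zero_apply]
        rw [integral_const_mul, integral_sub (integrable_of_abs_le hφ hb) (integrable_const _)]
        simp
  · exact (mdev s hsT).mul (mdev t htT)
  · intro ω
    have := mul_le_mul (bdev s hsT ω) (bdev t htT ω) (abs_nonneg _)
      ((abs_nonneg _).trans (bdev s hsT ω))
    rw [← abs_mul] at this
    exact this

end SalesProcess

/-! ### Empirical risk minimization -/

/-- A lower bound on second derivatives gives a quadratic lower bound on increments. -/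
lemma sum_add_le_of_second_deriv_ge {d : ℕ} {ι : Type*} (s : Finset ι) {g : ι → Vec d → ℝ}
    {C : Set (Vec d)} (hC : Convex ℝ C) {a b : Vec d} (ha : a ∈ C) (hb : b ∈ C)
    (hg : ∀ i ∈ s, ∀ θ ∈ C, ContDiffAt ℝ 2 (g i) θ) {m : ℝ}
    (hm : ∀ θ ∈ C, m ≤ ∑ i ∈ s, iteratedFDeriv ℝ 2 (g i) θ ![b - a, b - a]) :
    ∑ i ∈ s, g i a + ∑ i ∈ s, fderiv ℝ (g i) a (b - a) + m / 2 ≤ ∑ i ∈ s, g i b := by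
  set Δ := b - a with hΔ
  have hseg : ∀ r ∈ Set.Icc (0 : ℝ) 1, a + r • Δ ∈ C := fun r hr =>
    hC.add_smul_sub_mem ha hb hr
  have hline : ∀ r : ℝ, HasDerivAt (fun r : ℝ => a + r • Δ) Δ r := fun r => by
    simpa using ((hasDerivAt_id r).smul_const Δ).const_add a
  have h1 : ∀ r ∈ Set.Icc (0 : ℝ) 1, HasDerivAt (fun r => ∑ i ∈ s, g i (a + r • Δ))
      (∑ i ∈ s, fderiv ℝ (g i) (a + r • Δ) Δ) r := fun r hr =>
    HasDerivAt.fun_sum fun i hi =>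
      ((hg i hi _ (hseg r hr)).differentiableAt two_ne_zero).hasFDerivAt.comp_hasDerivAt r (hline r)
  have h2 : ∀ r ∈ Set.Icc (0 : ℝ) 1, HasDerivAt (fun r => ∑ i ∈ s, fderiv ℝ (g i) (a + r • Δ) Δ)
      (∑ i ∈ s, iteratedFDeriv ℝ 2 (g i) (a + r • Δ) ![Δ, Δ]) r := fun r hr => by
    refine HasDerivAt.fun_sum fun i hi => ?_
    have hd : DifferentiableAt ℝ (fderiv ℝ (g i)) (a + r • Δ) :=
      ((hg i hi _ (hseg r hr)).fderiv_right (m := 1) (by norm_num)).differentiableAt one_ne_zero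
    have h3 := hd.hasFDerivAt.comp_hasDerivAt r (hline r)
    have h4 := h3.clm_apply (hasDerivAt_const r Δ)
    rw [iteratedFDeriv_two_apply]
    simpa using h4
  set D₀ := ∑ i ∈ s, fderiv ℝ (g i) a Δ with hD₀
  have h3 : ∀ r ∈ Set.Icc (0 : ℝ) 1,
      HasDerivAt (fun r => ∑ i ∈ s, fderiv ℝ (g i) (a + r • Δ) Δ - m * r)
      (∑ i ∈ s, iteratedFDeriv ℝ 2 (g i) (a + r • Δ) ![Δ, Δ] - m) r := fun r hr => by
    simpa using (h2 r hr).fun_sub ((hasDerivAt_id r).const_mul m)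
  -- Taylor's inequality by two monotonicity arguments: the derivative minus `m r` increases, hence
  -- so does the function minus its linear part and `m r² / 2`.
  have mono1 : MonotoneOn (fun r => ∑ i ∈ s, fderiv ℝ (g i) (a + r • Δ) Δ - m * r)
      (Set.Icc 0 1) := by
    refine monotoneOn_of_hasDerivWithinAt_nonneg (convex_Icc 0 1)
      (fun r hr => (h3 r hr).continuousAt.continuousWithinAt)
      (fun r hr => (h3 r (interior_subset hr)).hasDerivWithinAt) fun r hr => ?_
    linarith [hm _ (hseg r (interior_subset hr))]
  have h4 : ∀ r ∈ Set.Icc (0 : ℝ) 1,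
      HasDerivAt (fun r => ∑ i ∈ s, g i (a + r • Δ) - D₀ * r - m / 2 * r ^ 2)
      (∑ i ∈ s, fderiv ℝ (g i) (a + r • Δ) Δ - D₀ - m * r) r := fun r hr => by
    refine (((h1 r hr).fun_sub ((hasDerivAt_id r).const_mul D₀)).fun_sub
      ((hasDerivAt_pow 2 r).const_mul (m / 2))).congr_deriv ?_
    norm_num
    ring
  have mono2 : MonotoneOn (fun r => ∑ i ∈ s, g i (a + r • Δ) - D₀ * r - m / 2 * r ^ 2)
      (Set.Icc 0 1) := by
    refine monotoneOn_of_hasDerivWithinAt_nonneg (convex_Icc 0 1)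
      (fun r hr => (h4 r hr).continuousAt.continuousWithinAt)
      (fun r hr => (h4 r (interior_subset hr)).hasDerivWithinAt) fun r hr => ?_
    have hr' := interior_subset hr
    have := mono1 (Set.left_mem_Icc.2 zero_le_one) hr' hr'.1
    simp only [zero_smul, add_zero, mul_zero, sub_zero] at this
    linarith
  have := mono2 (Set.left_mem_Icc.2 zero_le_one) (Set.right_mem_Icc.2 zero_le_one) zero_le_one
  have hab : a + (1 : ℝ) • Δ = b := by rw [hΔ]; simp
  simp only [hab] at this
  simp only [zero_smul, add_zero, mul_zero, sub_zero, mul_one, one_pow] at this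
  linarith

lemma quadForm_ge_of_abs_le {d : ℕ} {A : Matrix (Fin d) (Fin d) ℝ} {ε : ℝ} (hε : 0 ≤ ε)
    (hA : ∀ i j, |A i j| ≤ ε) (v : Fin d → ℝ) :
    -(ε * d * ∑ i, v i ^ 2) ≤ v ⬝ᵥ A.mulVec v := by
  have h1 : -(v ⬝ᵥ A.mulVec v) ≤ ε * (∑ i, |v i|) ^ 2 := by
    rw [sq, Finset.sum_mul_sum, Finset.mul_sum]
    simp only [dotProduct, Matrix.mulVec, Finset.mul_sum]
    rw [← Finset.sum_neg_distrib]
    refine Finset.sum_le_sum fun i _ => ?_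
    rw [← Finset.sum_neg_distrib]
    refine Finset.sum_le_sum fun j _ => (neg_le_abs _).trans ?_
    rw [abs_mul, abs_mul]
    have := mul_le_mul_of_nonneg_left (hA i j) (mul_nonneg (abs_nonneg (v i)) (abs_nonneg (v j)))
    linarith
  have h2 : (∑ i, |v i|) ^ 2 ≤ d * ∑ i, v i ^ 2 := by
    have := sq_sum_le_card_mul_sum_sq (s := (Finset.univ : Finset (Fin d))) (f := fun i => |v i|)
    simpa using this
  nlinarith [mul_le_mul_of_nonneg_left h2 hε]

namespace Model

variable {d : ℕ} {M : Model d}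

/-- The risk of a record as a function of the parameter. -/
def risk (M : Model d) (o : Obs d) : Vec d → ℝ := M.ρ o.2.2 o.2.1 o.1

lemma contDiffAt_risk (hC1 : M.C1) {o : Obs d} (ho : o ∈ M.admissible) {θ : Vec d}
    (hθ : θ ∈ M.params) : ContDiffAt ℝ 3 (M.risk o) θ :=
  hC1.smooth _ ho.2.2 _ ho.2.1 _ ho.1 _ hθ

/-- The bound on third derivatives makes the second derivative `B`-Lipschitz by the mean value
inequality. That inequality needs a convex domain, which is why the assumptions range over the hull
of `Θ`. -/
lemma second_deriv_risk_sub_le (hC1 : M.C1) {B : ℝ} (hB : M.RiskBound B) {o : Obs d}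
    (ho : o ∈ M.admissible) {θ θ' : Vec d} (hθ : θ ∈ M.params) (hθ' : θ' ∈ M.params) (v : Vec d) :
    iteratedFDeriv ℝ 2 (M.risk o) θ' ![v, v] - B * ‖θ' - θ‖ * ‖v‖ ^ 2
      ≤ iteratedFDeriv ℝ 2 (M.risk o) θ ![v, v] := by
  have h : ‖iteratedFDeriv ℝ 2 (M.risk o) θ' - iteratedFDeriv ℝ 2 (M.risk o) θ‖
      ≤ B * ‖θ' - θ‖ := by
    refine (convex_convexHull ℝ M.Θ).norm_image_sub_le_of_norm_fderiv_le
      (fun z hz => (contDiffAt_risk hC1 ho hz).differentiableAt_iteratedFDeriv (by norm_num))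
      (fun z hz => ?_) hθ hθ'
    rw [norm_fderiv_iteratedFDeriv]
    exact hB _ ho.2.2 _ ho.2.1 _ ho.1 _ hz 3 le_rfl
  have h2 := (iteratedFDeriv ℝ 2 (M.risk o) θ' - iteratedFDeriv ℝ 2 (M.risk o) θ).le_opNorm ![v, v]
  rw [Fin.prod_univ_two] at h2
  simp only [Matrix.cons_val_zero, Matrix.cons_val_one, sub_apply,
    Real.norm_eq_abs] at h2
  have h3 := (le_abs_self _).trans (h2.trans
    (mul_le_mul_of_nonneg_right h (mul_nonneg (norm_nonneg v) (norm_nonneg v))))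
  rw [sq]
  linarith

/-- An error bound for minimizers of the empirical risk, in terms of the gradient at the true
parameter and of the deviations of the Hessian matrices on a finite net. -/
lemma erm_error_sq_le (hd : 0 < d) (hA1 : M.A1) (hC1 : M.C1) {B κ r R : ℝ} (hκ : 0 < κ)
    (hB0 : 0 ≤ B) (hB : M.RiskBound B) (hBr : B * r ≤ κ / 4) {N : Finset (Vec d)}
    (hN : ∀ θ ∈ N, θ ∈ M.params) (hnet : ∀ θ ∈ M.params, ∃ θ' ∈ N, ‖θ' - θ‖ ≤ r)
    (hR : ∀ θ ∈ M.Θ, ‖θ - M.θ₀‖ ≤ R) {n : ℕ} (hn : 0 < n) {o : ℕ → Obs d}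
    (ho : ∀ t < n, o t ∈ M.admissible) {K : Vec d → Matrix (Fin d) (Fin d) ℝ}
    (hK : ∀ θ ∈ N, ∀ v : Fin d → ℝ, n * κ * ∑ i, v i ^ 2 ≤ v ⬝ᵥ (K θ).mulVec v)
    {θ : Vec d} (hθ : θ ∈ M.Θ)
    (hmin : ∑ t ∈ Finset.range n, M.risk (o t) θ ≤ ∑ t ∈ Finset.range n, M.risk (o t) M.θ₀) :
    ‖θ - M.θ₀‖ ^ 2 ≤ 64 / (κ * n) ^ 2 * ∑ i, (∑ t ∈ Finset.range n, M.cutGradRho i (o t)) ^ 2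
      + (2 * d * R / (κ * n)) ^ 2 * ∑ θ' ∈ N, ∑ i, ∑ j,
        (∑ t ∈ Finset.range n, M.cutHess θ' i j (o t) - K θ' i j) ^ 2 := by
  have hn' : (0 : ℝ) < n := by exact_mod_cast hn
  have hd' : (0 : ℝ) < d := by exact_mod_cast hd
  have hθ₀ := M.Θ_subset_params hA1.true_mem
  set V : Vec d → Matrix (Fin d) (Fin d) ℝ :=
    fun θ' i j => ∑ t ∈ Finset.range n, M.cutHess θ' i j (o t) - K θ' i j with hV
  set P : Vec d := WithLp.toLp 2 fun i => ∑ t ∈ Finset.range n, M.cutGradRho i (o t) with hP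
  have hPn : ∑ i, (∑ t ∈ Finset.range n, M.cutGradRho i (o t)) ^ 2 = ‖P‖ ^ 2 := by
    rw [norm_sq_eq_sum]
  rw [hPn]
  change _ ≤ _ + _ * ∑ θ' ∈ N, ∑ i, ∑ j, V θ' i j ^ 2
  -- If all Hessian deviations on the net are small, strong convexity yields the first summand of
  -- the bound; otherwise the second summand already exceeds `R²`.
  by_cases hgood : ∀ θ' ∈ N, ∀ i j, |V θ' i j| ≤ κ * n / (2 * d)
  · have hquad : ∀ θ' ∈ M.params, n * κ / 4 * ‖θ - M.θ₀‖ ^ 2 ≤ ∑ t ∈ Finset.range n,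
        iteratedFDeriv ℝ 2 (M.risk (o t)) θ' ![θ - M.θ₀, θ - M.θ₀] := by
      intro θ' hθ'
      -- Curvature budget: `nκ` from the conditional means at the net point `z`, minus `nκ/2` for
      -- the deviations there, minus `nκ/4` for moving from `z` to `θ'`.
      obtain ⟨z, hz, hzr⟩ := hnet θ' hθ'
      set v := θ - M.θ₀
      have h1 : n * κ / 2 * ‖v‖ ^ 2 ≤ ∑ t ∈ Finset.range n,
          iteratedFDeriv ℝ 2 (M.risk (o t)) z ![v, v] := by
        have e : ∑ t ∈ Finset.range n, iteratedFDeriv ℝ 2 (M.risk (o t)) z ![v, v]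
            = (v : Fin d → ℝ) ⬝ᵥ (K z).mulVec v + (v : Fin d → ℝ) ⬝ᵥ (V z).mulVec v := by
          rw [← dotProduct_add, ← Matrix.add_mulVec]
          have : K z + V z = ∑ t ∈ Finset.range n, hessian (M.risk (o t)) z := by
            ext i j
            have hVe : V z i j = ∑ t ∈ Finset.range n, M.cutHess z i j (o t) - K z i j := rfl
            rw [Matrix.add_apply, hVe, add_sub_cancel, Matrix.sum_apply]
            refine Finset.sum_congr rfl fun t ht => ?_
            exact Set.indicator_of_mem (ho t (Finset.mem_range.1 ht))
              fun o : Obs d => hessian (M.ρ o.2.2 o.2.1 o.1) z i j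
          rw [this, Matrix.sum_mulVec, dotProduct_sum]
          simp_rw [quadForm_hessian]
        have h2 := hK z hz v
        have h3 := quadForm_ge_of_abs_le (by positivity) (hgood z hz) v
        have h4 : κ * n / (2 * d) * d = n * κ / 2 := by field_simp
        rw [h4, ← norm_sq_eq_sum] at h3
        rw [← norm_sq_eq_sum] at h2
        rw [e]
        linarith
      have h5 : ∑ t ∈ Finset.range n, (iteratedFDeriv ℝ 2 (M.risk (o t)) z ![v, v]
          - κ / 4 * ‖v‖ ^ 2) ≤ ∑ t ∈ Finset.range n,
          iteratedFDeriv ℝ 2 (M.risk (o t)) θ' ![v, v] := by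
        refine Finset.sum_le_sum fun t ht => ?_
        have h6 := second_deriv_risk_sub_le hC1 hB (ho t (Finset.mem_range.1 ht)) hθ' (hN z hz) v
        have h7 : B * ‖z - θ'‖ ≤ κ / 4 := (mul_le_mul_of_nonneg_left hzr hB0).trans hBr
        nlinarith [mul_le_mul_of_nonneg_right h7 (sq_nonneg ‖v‖)]
      rw [Finset.sum_sub_distrib, Finset.sum_const, Finset.card_range, nsmul_eq_mul] at h5
      linarith
    have h1 := sum_add_le_of_second_deriv_ge (Finset.range n) (g := fun t => M.risk (o t))
      (convex_convexHull ℝ M.Θ) hθ₀ (M.Θ_subset_params hθ)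
      (fun t ht z hz => (contDiffAt_risk hC1 (ho t (Finset.mem_range.1 ht)) hz).of_le
        (by norm_num)) hquad
    have h2 : ∑ t ∈ Finset.range n, fderiv ℝ (M.risk (o t)) M.θ₀ (θ - M.θ₀)
        = inner ℝ P (θ - M.θ₀) := by
      have e : P = ∑ t ∈ Finset.range n, gradient (M.risk (o t)) M.θ₀ := by
        ext i
        simp only [hP, WithLp.ofLp_sum, Finset.sum_apply]
        refine Finset.sum_congr rfl fun t ht => ?_
        exact Set.indicator_of_mem (ho t (Finset.mem_range.1 ht))
          fun o : Obs d => gradient (M.ρ o.2.2 o.2.1 o.1) M.θ₀ i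
      rw [e, sum_inner]
      refine Finset.sum_congr rfl fun t _ => ?_
      rw [gradient, InnerProductSpace.toDual_symm_apply]
    have h3 := abs_real_inner_le_norm P (θ - M.θ₀)
    rw [h2] at h1
    have h4 : n * κ / 8 * ‖θ - M.θ₀‖ ^ 2 ≤ ‖P‖ * ‖θ - M.θ₀‖ := by
      have := neg_abs_le (inner ℝ P (θ - M.θ₀))
      linarith
    have h5 : κ * n * ‖θ - M.θ₀‖ ≤ 8 * ‖P‖ := by
      rcases (norm_nonneg (θ - M.θ₀)).eq_or_lt with h0 | h0
      · rw [← h0]; simp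
      · refine le_of_mul_le_mul_right ?_ h0
        nlinarith
    have h6 : ‖θ - M.θ₀‖ ^ 2 ≤ 64 / (κ * n) ^ 2 * ‖P‖ ^ 2 := by
      rw [div_mul_eq_mul_div, le_div_iff₀ (by positivity)]
      have := pow_le_pow_left₀ (by positivity) h5 2
      nlinarith
    exact h6.trans (le_add_of_nonneg_right (by positivity))
  · push Not at hgood
    obtain ⟨z, hz, i, j, hij⟩ := hgood
    have h1 : (κ * n / (2 * d)) ^ 2 ≤ ∑ θ' ∈ N, ∑ i, ∑ j, V θ' i j ^ 2 := by
      calc (κ * n / (2 * d)) ^ 2 ≤ |V z i j| ^ 2 := pow_le_pow_left₀ (by positivity) hij.le 2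
        _ = V z i j ^ 2 := sq_abs _
        _ ≤ ∑ j, V z i j ^ 2 := Finset.single_le_sum (f := fun j => V z i j ^ 2)
            (fun j _ => sq_nonneg _) (Finset.mem_univ j)
        _ ≤ ∑ i, ∑ j, V z i j ^ 2 := Finset.single_le_sum (f := fun i => ∑ j, V z i j ^ 2)
            (fun i _ => Finset.sum_nonneg fun j _ => sq_nonneg _) (Finset.mem_univ i)
        _ ≤ _ := Finset.single_le_sum (f := fun z => ∑ i, ∑ j, V z i j ^ 2)
            (fun z _ => Finset.sum_nonneg fun i _ => Finset.sum_nonneg fun j _ => sq_nonneg _) hz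
    have h2 : ‖θ - M.θ₀‖ ^ 2 ≤ R ^ 2 := pow_le_pow_left₀ (norm_nonneg _) (hR θ hθ) 2
    -- The coefficient is chosen so that a single entry above the threshold `κn/(2d)` pays for the
    -- trivial bound `R²`.
    have h3 : R ^ 2 = (2 * d * R / (κ * n)) ^ 2 * (κ * n / (2 * d)) ^ 2 := by
      field_simp
    refine le_trans ?_ (le_add_of_nonneg_left (by positivity))
    rw [h3] at h2
    exact h2.trans (mul_le_mul_of_nonneg_left h1 (sq_nonneg _))

end Model

namespace SalesProcess

section
variable {d : ℕ} {M : Model d} {T : ℕ} {Ω : Type*} [MeasurableSpace Ω] {μ : Measure Ω}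
  {S : SalesProcess M T μ} {erm : (n : ℕ) → (Fin n → Obs d) → Vec d}

lemma pilot_mem (herm : IsERM M erm) {n : ℕ} (hn : n ≤ T) (ω : Ω) : S.pilot erm n ω ∈ M.Θ :=
  herm.mem n _ fun s => obs_mem (s.2.trans_le hn) ω

lemma measurable_pilot (herm : IsERM M erm) {n : ℕ} (hn : n ≤ T) :
    Measurable (S.pilot erm n) := (herm.measurable n).comp (measurable_history hn)

lemma sum_risk_pilot_le (hA1 : M.A1) (herm : IsERM M erm) {n : ℕ} (hn : n ≤ T) (ω : Ω) :
    ∑ t ∈ Finset.range n, M.risk (S.obs t ω) (S.pilot erm n ω)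
      ≤ ∑ t ∈ Finset.range n, M.risk (S.obs t ω) M.θ₀ := by
  rw [Finset.sum_range, Finset.sum_range]
  exact herm.isMinOn n _ (fun s => obs_mem (s.2.trans_le hn) ω) hA1.true_mem

end

-- Mean squared error of the pilot estimate.

universe u

/-- The mean squared error of the empirical risk minimizer after `n` periods is of order `1/n`. -/
theorem exists_integral_pilot_error_sq_le {d : ℕ} (hd : 0 < d) {M : Model d} (hA1 : M.A1)
    (hB1 : M.B1) (hC1 : M.C1) (hC2 : M.C2) {κ : ℝ} (hκ : 0 < κ)
    {erm : (n : ℕ) → (Fin n → Obs d) → Vec d} (herm : IsERM M erm) :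
    ∃ C : ℝ, 0 ≤ C ∧ ∀ (T : ℕ) (Ω : Type u) [MeasurableSpace Ω] (μ : Measure Ω)
      [IsProbabilityMeasure μ] (S : SalesProcess M T μ), S.D1 κ → ∀ n ≤ T,
      Integrable (fun ω => ‖S.pilot erm n ω - M.θ₀‖ ^ 2) μ ∧
        ∫ ω, ‖S.pilot erm n ω - M.θ₀‖ ^ 2 ∂μ ≤ C / (n + 1) := by
  obtain ⟨B₀, hB₀⟩ := hC1.bounded
  set B := max B₀ 1
  have hB1' : 0 < B := lt_max_of_lt_right one_pos
  have hB : M.RiskBound B := fun y hy p hp x hx θ hθ k hk =>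
    (hB₀ y hy p hp x hx θ hθ k hk).trans (le_max_left _ _)
  obtain ⟨R, hRb⟩ := hA1.params_compact.isBounded.subset_closedBall M.θ₀
  have hR : ∀ θ ∈ M.Θ, ‖θ - M.θ₀‖ ≤ R := fun θ hθ => by
    rw [← dist_eq_norm]; exact hRb hθ
  have htb : TotallyBounded M.params := hA1.params_compact.totallyBounded.convexHull
  obtain ⟨N₀, hN₀, hfin, hcov⟩ :=
    -- At radius `κ/(4B)`, passing to the nearest net point changes each second derivative by at
    -- most `κ/4` times `‖v‖²`.
    Metric.finite_approx_of_totallyBounded htb (κ / 4 / B) (by positivity)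
  set N := hfin.toFinset with hNdef
  have hN : ∀ θ ∈ N, θ ∈ M.params := fun θ hθ => hN₀ (hfin.mem_toFinset.1 hθ)
  have hnet : ∀ θ ∈ M.params, ∃ θ' ∈ N, ‖θ' - θ‖ ≤ κ / 4 / B := fun θ hθ => by
    obtain ⟨z, hz, hzr⟩ := Set.mem_iUnion₂.1 (hcov hθ)
    refine ⟨z, hfin.mem_toFinset.2 hz, ?_⟩
    rw [← dist_eq_norm, dist_comm]
    exact (Metric.mem_ball.1 hzr).le
  set C₁ := 64 / κ ^ 2 * (d * (2 * B) ^ 2)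
  set C₂ := (2 * d * R / κ) ^ 2 * (N.card * (d * (d * (2 * B) ^ 2)))
  have hC₁ : 0 ≤ C₁ := by positivity
  have hC₂ : 0 ≤ C₂ := by positivity
  -- The factor 2 turns `1/n` into `1/(n+1)`; `R²` covers `n = 0`, where the estimate is merely some
  -- point of `Θ`. The constant is fixed before the horizon and the process.
  refine ⟨2 * (C₁ + C₂) + R ^ 2, by positivity, fun T Ω _ μ _ S hD1 n hn => ?_⟩
  have hle : ∀ ω, ‖S.pilot erm n ω - M.θ₀‖ ^ 2 ≤ R ^ 2 := fun ω =>
    pow_le_pow_left₀ (norm_nonneg _) (hR _ (pilot_mem herm hn ω)) 2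
  have hmeas : Measurable fun ω => ‖S.pilot erm n ω - M.θ₀‖ ^ 2 :=
    ((measurable_pilot herm hn).sub_const _).norm.pow_const 2
  have hint : Integrable (fun ω => ‖S.pilot erm n ω - M.θ₀‖ ^ 2) μ :=
    integrable_of_abs_le hmeas fun ω => by rw [abs_of_nonneg (by positivity)]; exact hle ω
  refine ⟨hint, ?_⟩
  rcases Nat.eq_zero_or_pos n with rfl | hpos
  · have h1 : ∫ ω, ‖S.pilot erm 0 ω - M.θ₀‖ ^ 2 ∂μ ≤ ∫ _, R ^ 2 ∂μ :=
      integral_mono hint (integrable_const _) hle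
    simp only [integral_const, probReal_univ, one_smul] at h1
    rw [Nat.cast_zero, zero_add, div_one]
    linarith
  have hn' : (1 : ℝ) ≤ n := by exact_mod_cast hpos
  have hn0 : (0 : ℝ) < n := by linarith
  set X : Fin d → Ω → ℝ := fun i ω => (∑ t ∈ Finset.range n, S.deviation (M.cutGradRho i) t ω) ^ 2
  set Y : Vec d → Fin d → Fin d → Ω → ℝ := fun θ i j ω =>
    (∑ t ∈ Finset.range n, S.deviation (M.cutHess θ i j) t ω) ^ 2
  have hX : ∀ i, Integrable (X i) μ ∧ ∫ ω, X i ω ∂μ ≤ n * (2 * B) ^ 2 := fun i =>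
    integral_sum_deviation_sq_le hB1 (M.measurable_cutGradRho hA1 hB1 hC1 i)
      (Model.abs_cutGradRho_le hA1 hB1'.le hB i) hn
  have hY : ∀ θ ∈ N, ∀ i j, Integrable (Y θ i j) μ ∧ ∫ ω, Y θ i j ω ∂μ ≤ n * (2 * B) ^ 2 :=
    fun θ hθ i j => integral_sum_deviation_sq_le hB1
      (M.measurable_cutHess hA1 hB1 hC1 (hN θ hθ) i j)
      (Model.abs_cutHess_le hB1'.le hB (hN θ hθ) i j) hn
  have hae : ∀ᵐ ω ∂μ, ‖S.pilot erm n ω - M.θ₀‖ ^ 2 ≤ 64 / (κ * n) ^ 2 * ∑ i, X i ω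
      + (2 * d * R / (κ * n)) ^ 2 * ∑ θ ∈ N, ∑ i, ∑ j, Y θ i j ω := by
    have h1 : ∀ᵐ ω ∂μ, ∀ t, t < n → ∀ θ ∈ M.params, ∀ v : Fin d → ℝ,
        κ * ∑ i, v i ^ 2 ≤ v ⬝ᵥ (Matrix.of fun i j => ∫ o : Obs d, M.cutHess θ i j o
          ∂(S.step t (S.history t ω))).mulVec v := by
      rw [ae_all_iff]
      intro t
      by_cases ht : t < n
      · filter_upwards [quadForm_le_integral_step hA1 hB1 hC1 hD1 (ht.trans_le hn)] with ω hω _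
        exact hω
      · exact ae_of_all _ fun ω h => absurd h ht
    filter_upwards [h1] with ω hω
    have key := Model.erm_error_sq_le hd hA1 hC1 hκ hB1'.le hB
      (r := κ / 4 / B) (by field_simp; rfl) hN hnet hR hpos
      (o := fun t => S.obs t ω) (fun t ht => obs_mem (ht.trans_le hn) ω)
      (K := fun θ => ∑ t ∈ Finset.range n, Matrix.of fun i j => ∫ o : Obs d, M.cutHess θ i j o
          ∂(S.step t (S.history t ω)))
      (fun θ hθ v => by
        rw [Matrix.sum_mulVec, dotProduct_sum]
        have := Finset.card_nsmul_le_sum (Finset.range n) _ _ fun t ht =>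
          hω t (Finset.mem_range.1 ht) θ (hN θ hθ) v
        rw [Finset.card_range, nsmul_eq_mul, ← mul_assoc] at this
        exact this)
      (pilot_mem herm hn ω) (sum_risk_pilot_le hA1 herm hn ω)
    have eX : ∀ i, (∑ t ∈ Finset.range n, M.cutGradRho i (S.obs t ω)) ^ 2 = X i ω := by
      intro i
      refine congrArg (· ^ 2) (Finset.sum_congr rfl fun t ht => ?_)
      rw [deviation, integral_step_cutGradRho hA1 hB1 hC1 hC2
        ((Finset.mem_range.1 ht).trans_le hn), sub_zero]
    have eY : ∀ θ i j, (∑ t ∈ Finset.range n, M.cutHess θ i j (S.obs t ω)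
        - (∑ t ∈ Finset.range n, Matrix.of fun i j => ∫ o : Obs d, M.cutHess θ i j o
          ∂(S.step t (S.history t ω))) i j) ^ 2 = Y θ i j ω := by
      intro θ i j
      rw [Matrix.sum_apply, ← Finset.sum_sub_distrib]
      rfl
    simp_rw [eX, eY] at key
    exact key
  have iX : Integrable (fun ω => ∑ i, X i ω) μ := integrable_finsetSum _ fun i _ => (hX i).1
  have iYj : ∀ θ ∈ N, ∀ i, Integrable (fun ω => ∑ j, Y θ i j ω) μ := fun θ hθ i =>
    integrable_finsetSum _ fun j _ => (hY θ hθ i j).1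
  have iYi : ∀ θ ∈ N, Integrable (fun ω => ∑ i, ∑ j, Y θ i j ω) μ := fun θ hθ =>
    integrable_finsetSum _ fun i _ => iYj θ hθ i
  have iY : Integrable (fun ω => ∑ θ ∈ N, ∑ i, ∑ j, Y θ i j ω) μ := integrable_finsetSum _ iYi
  have bX : ∫ ω, ∑ i, X i ω ∂μ ≤ d * (n * (2 * B) ^ 2) := by
    rw [integral_finsetSum _ fun i _ => (hX i).1]
    refine (Finset.sum_le_card_nsmul _ _ _ fun i _ => (hX i).2).trans_eq ?_
    simp
  have bY : ∫ ω, ∑ θ ∈ N, ∑ i, ∑ j, Y θ i j ω ∂μ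
      ≤ N.card * (d * (d * (n * (2 * B) ^ 2))) := by
    rw [integral_finsetSum _ iYi, ← nsmul_eq_mul]
    refine Finset.sum_le_card_nsmul _ _ _ fun θ hθ => ?_
    rw [integral_finsetSum _ fun i _ => iYj θ hθ i]
    refine (Finset.sum_le_card_nsmul _ _ (d * (n * (2 * B) ^ 2)) fun i _ => ?_).trans_eq (by simp)
    rw [integral_finsetSum _ fun j _ => (hY θ hθ i j).1]
    exact (Finset.sum_le_card_nsmul _ _ _ fun j _ => (hY θ hθ i j).2).trans_eq (by simp)
  have hfin : ∫ ω, ‖S.pilot erm n ω - M.θ₀‖ ^ 2 ∂μ ≤ (C₁ + C₂) / n := by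
    refine (integral_mono_ae hint ((iX.const_mul _).add (iY.const_mul _)) hae).trans ?_
    simp only [Pi.add_apply]
    rw [integral_add (iX.const_mul _) (iY.const_mul _), integral_const_mul, integral_const_mul]
    refine (add_le_add (mul_le_mul_of_nonneg_left bX (by positivity))
      (mul_le_mul_of_nonneg_left bY (by positivity))).trans_eq ?_
    simp only [C₁, C₂]
    field_simp
  refine hfin.trans ?_
  rw [div_le_div_iff₀ hn0 (by positivity)]
  nlinarith [sq_nonneg R, mul_nonneg (sq_nonneg R) hn0.le]

end SalesProcess

/-! ### The whitening procedure on the data -/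

lemma measurable_mulVecE {d : ℕ} {α : Type*} {m : MeasurableSpace α}
    {Z : α → Matrix (Fin d) (Fin d) ℝ} {u : α → Vec d} (hZ : ∀ i j, Measurable fun a => Z a i j)
    (hu : Measurable u) : Measurable fun a => mulVecE (Z a) (u a) := by
  refine Model.measurable_vec fun i => ?_
  simp_rw [mulVecE_apply]
  exact Finset.measurable_fun_sum _ fun j _ =>
    (hZ i j).mul ((Model.measurable_vec_apply j).comp hu)

lemma measurable_whitenColumn {d : ℕ} {α : Type*} {m : MeasurableSpace α} (η : ℝ)
    {Z : α → Matrix (Fin d) (Fin d) ℝ} {u : α → Vec d} (hZ : ∀ i j, Measurable fun a => Z a i j)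
    (hu : Measurable u) : Measurable fun a => whitenColumn η (Z a) (u a) := by
  have hw : Measurable fun a => (‖u a‖ ^ 2)⁻¹ • mulVecE (Z a) (u a) :=
    (hu.norm.pow_const 2).inv.smul (measurable_mulVecE hZ hu)
  unfold whitenColumn
  exact Measurable.ite (measurableSet_le measurable_const hw.norm)
    ((measurable_const.div hw.norm).smul hw) hw

lemma measurable_whitenRemainder {d : ℕ} {α : Type*} {m : MeasurableSpace α} (η : ℝ)
    {u : ℕ → α → Vec d} (t : ℕ) (hu : ∀ s < t, Measurable (u s)) (i j : Fin d) :
    Measurable fun a => whitenRemainder η (fun s => u s a) t i j := by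
  induction t generalizing i j with
  | zero => exact measurable_const
  | succ t ih =>
    have hZ := ih fun s hs => hu s (by omega)
    have hw := measurable_whitenColumn η hZ (hu t (by omega))
    exact (hZ i j).sub (((Model.measurable_vec_apply i).comp hw).mul
      ((Model.measurable_vec_apply j).comp (hu t (by omega))))

namespace SalesProcess

variable {d : ℕ} {M : Model d} {T : ℕ} {Ω : Type*} [MeasurableSpace Ω] {μ : Measure Ω}
  {S : SalesProcess M T μ} {erm : (n : ℕ) → (Fin n → Obs d) → Vec d}

lemma onlineGrad_eq (herm : IsERM M erm) {t : ℕ} (ht : t < T) (ω : Ω) :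
    S.onlineGrad erm t ω = M.cutGradF ((S.x t ω, S.p t ω), S.pilot erm t ω) :=
  (M.cutGradF_eq (S.x_mem t ht ω) (S.p_mem t ht ω) (pilot_mem herm ht.le ω)).symm

section
variable {α : Type*} {m : MeasurableSpace α} {π : α → Ω}

/-- The map `π` from an arbitrary measurable space allows one argument to serve the full
`σ`-algebra, the one generated by the history, and `info`. -/
lemma measurable_onlineGrad (hA1 : M.A1) (hA2 : M.A2) (herm : IsERM M erm) {t : ℕ} (ht : t < T)
    (hh : Measurable fun a => S.history t (π a)) (hx : Measurable fun a => S.x t (π a))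
    (hp : Measurable fun a => S.p t (π a)) : Measurable fun a => S.onlineGrad erm t (π a) := by
  simp_rw [onlineGrad_eq herm ht]
  exact (M.measurable_cutGradF hA1 hA2).comp
    ((hx.prodMk hp).prodMk ((herm.measurable t).comp hh))

/-- The records before period `t` determine the gradients of the periods before `t`. -/
lemma measurable_onlineGrad_of_history (hA1 : M.A1) (hA2 : M.A2) (herm : IsERM M erm)
    {t : ℕ} (ht : t ≤ T) (hh : Measurable fun a => S.history t (π a)) {s : ℕ}
    (hs : s < t) : Measurable fun a => S.onlineGrad erm s (π a) := by
  have hobs : ∀ r < t, Measurable fun a => S.obs r (π a) := fun r hr =>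
    (measurable_pi_apply (⟨r, hr⟩ : Fin t)).comp hh
  exact measurable_onlineGrad hA1 hA2 herm (hs.trans_le ht)
    (measurable_pi_lambda _ fun r => hobs r (r.2.trans hs)) (hobs s hs).fst (hobs s hs).snd.fst

lemma measurable_whiten (hA1 : M.A1) (hA2 : M.A2) (herm : IsERM M erm) (η : ℝ)
    {t : ℕ} (ht : t < T) (hh : Measurable fun a => S.history t (π a))
    (hx : Measurable fun a => S.x t (π a)) (hp : Measurable fun a => S.p t (π a)) :
    Measurable fun a => S.whiten erm η t (π a) :=
  measurable_whitenColumn η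
    (measurable_whitenRemainder η (u := fun s a => S.onlineGrad erm s (π a)) t fun _ hs =>
      measurable_onlineGrad_of_history hA1 hA2 herm ht.le hh hs)
    (measurable_onlineGrad hA1 hA2 herm ht hh hx hp)

end

/-- Past columns can be recomputed from past records, so the records inside `info`, with `x_t` and
`p_t`, already determine `w_t`, whatever `w` is. -/
lemma measurable_info_whiten (hA1 : M.A1) (hA2 : M.A2) (herm : IsERM M erm) (η : ℝ)
    (w : ℕ → Ω → Vec d) {t : ℕ} (ht : t < T) :
    Measurable[S.info w t] (S.whiten erm η t) := by
  have h : Measurable[S.info w t] (fun ω =>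
      ((fun s : Fin t => (S.ξ s ω, S.p s ω, S.y s ω, S.x s ω, w s ω)), S.x t ω, S.p t ω)) :=
    comap_measurable _
  refine measurable_whiten (m := S.info w t) (π := id) hA1 hA2 herm η ht ?_ h.snd.fst h.snd.snd
  refine @measurable_pi_lambda _ _ _ (S.info w t) _ _ fun s => ?_
  have hs := (measurable_pi_apply s).comp h.fst
  exact hs.snd.snd.snd.fst.prodMk (hs.snd.fst.prodMk hs.snd.snd.fst)

/-- The squared Frobenius norm of the remainder of the whitening procedure. -/
noncomputable def residual (S : SalesProcess M T μ) (erm : (n : ℕ) → (Fin n → Obs d) → Vec d)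
    (η : ℝ) (t : ℕ) (ω : Ω) : ℝ :=
  frob (whitenRemainder η (fun s => S.onlineGrad erm s ω) t)

lemma measurable_residual (hA1 : M.A1) (hA2 : M.A2) (herm : IsERM M erm) (η : ℝ) {t : ℕ}
    (ht : t ≤ T) : Measurable (S.residual erm η t) := by
  unfold residual frob
  exact Finset.measurable_fun_sum _ fun i _ => Finset.measurable_fun_sum _ fun j _ =>
    (measurable_whitenRemainder η t (fun _ hs => measurable_onlineGrad_of_history (S := S)
      (π := id) hA1 hA2 herm ht (measurable_history ht) hs) i j).pow_const 2

/-- `B` bounds the gradients of the demand function. -/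
def _root_.DynamicPricing.Model.GradBound (M : Model d) (B : ℝ) : Prop :=
  ∀ p ∈ M.prices, ∀ x ∈ M.contexts, ∀ θ ∈ M.params, ‖gradient (M.f p x) θ‖ ≤ B

lemma norm_onlineGrad_le {B : ℝ} (hB : M.GradBound B) (herm : IsERM M erm) {t : ℕ} (ht : t < T)
    (ω : Ω) : ‖S.onlineGrad erm t ω‖ ≤ B :=
  hB _ (S.p_mem t ht ω) _ (S.x_mem t ht ω) _ (M.Θ_subset_params (pilot_mem herm ht.le ω))

/-- If the final remainder is small, then `W D Wᵀ` is well conditioned. -/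
lemma le_lamWDW (hd : 0 < d) (herm : IsERM M erm) {a b B η : ℝ} (ha : 0 < a)
    (hν : ∀ p ∈ M.prices, ∀ x ∈ M.contexts, a ≤ M.ν p x M.θ₀ ∧ M.ν p x M.θ₀ ≤ b)
    (hB : M.GradBound B) (hB0 : 0 < B) (hT : 0 < T) {ω : Ω}
    (hω : S.residual erm η T ω ≤ 1 / 4) :
    a ^ 2 / (4 * B ^ 2) / T ≤ S.lamWDW (S.whiten erm η) ω := by
  have hT' : (0 : ℝ) < T := by exact_mod_cast hT
  have hquad : ∀ v : Fin d → ℝ, v ⬝ᵥ (S.matW (S.whiten erm η) ω * S.matD ω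
      * (S.matW (S.whiten erm η) ω).transpose).mulVec v
      = ∑ t : Fin T, M.ν (S.p t ω) (S.x t ω) M.θ₀ ^ 2 * (∑ i, v i * S.whiten erm η t ω i) ^ 2 := by
    intro v
    rw [← Matrix.mulVec_mulVec, ← Matrix.mulVec_mulVec, Matrix.dotProduct_mulVec, dotProduct]
    refine Finset.sum_congr rfl fun t _ => ?_
    rw [matD, Matrix.mulVec_diagonal, Matrix.mulVec_transpose]
    have : Matrix.vecMul v (S.matW (S.whiten erm η) ω) t
        = ∑ i, v i * S.whiten erm η t ω i := rfl
    rw [this]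
    ring
  refine le_lamMin_of_quadForm_ge hd ?_ fun v => ?_
  · rw [Matrix.IsHermitian, Matrix.conjTranspose_eq_transpose_of_trivial, Matrix.transpose_mul,
      Matrix.transpose_mul, Matrix.transpose_transpose, matD, Matrix.diagonal_transpose,
      Matrix.mul_assoc]
  · rw [hquad]
    have hZ : frob (1 - ∑ s ∈ Finset.range T,
        Matrix.vecMulVec (S.whiten erm η s ω) (S.onlineGrad erm s ω)) ≤ 1 / 4 := by
      have := hω
      rw [residual, whitenRemainder_eq] at this
      exact this
    have h1 := sum_inner_sq_ge (fun s => S.whiten erm η s ω) (fun s => S.onlineGrad erm s ω)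
      (fun t ht => norm_onlineGrad_le hB herm ht ω) hZ (WithLp.toLp 2 v)
    rw [norm_sq_eq_sum, Finset.sum_range] at h1
    have h2 : a ^ 2 * ∑ t : Fin T, (∑ i, v i * S.whiten erm η t ω i) ^ 2
        ≤ ∑ t : Fin T, M.ν (S.p t ω) (S.x t ω) M.θ₀ ^ 2
          * (∑ i, v i * S.whiten erm η t ω i) ^ 2 := by
      rw [Finset.mul_sum]
      refine Finset.sum_le_sum fun t _ => mul_le_mul_of_nonneg_right ?_ (sq_nonneg _)
      exact pow_le_pow_left₀ ha.le (hν _ (S.p_mem t t.2 ω) _ (S.x_mem t t.2 ω)).1 2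
    refine le_trans ?_ h2
    rw [div_div, div_mul_eq_mul_div, div_le_iff₀ (by positivity)]
    have h3 := mul_le_mul_of_nonneg_left h1 (sq_nonneg a)
    refine h3.trans_eq ?_
    ring

/-- Telescoping the recursion gives `I - WG = Z_T + ∑ w_t (u_t - g_t)ᵀ`. Each summand has norm at
most `η L ‖θ̂_t - θ̂ᵖ‖`, and the two estimates are compared through `θ₀`. -/
lemma opNorm_bias_le (herm : IsERM M erm) {L η : ℝ} (hη : 0 < η)
    (hL0 : 0 ≤ L) (hL : ∀ p ∈ M.prices, ∀ x ∈ M.contexts, ∀ θ ∈ M.params, ∀ θ' ∈ M.params,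
      ‖gradient (M.f p x) θ - gradient (M.f p x) θ'‖ ≤ L * ‖θ - θ'‖) (ω : Ω) :
    opNorm (1 - S.matW (S.whiten erm η) ω * S.matG erm ω) ≤ √(S.residual erm η T ω)
      + η * L * ∑ t ∈ Finset.range T,
        (‖S.pilot erm t ω - M.θ₀‖ + ‖S.pilot erm T ω - M.θ₀‖) := by
  set g : ℕ → Vec d := fun t => gradient (M.f (S.p t ω) (S.x t ω)) (S.pilot erm T ω) with hg
  have e : 1 - S.matW (S.whiten erm η) ω * S.matG erm ω
      = whitenRemainder η (fun s => S.onlineGrad erm s ω) T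
        + ∑ t ∈ Finset.range T, Matrix.vecMulVec (S.whiten erm η t ω)
          (S.onlineGrad erm t ω - g t : Vec d) := by
    rw [whitenRemainder_eq]
    ext i j
    simp only [Matrix.sub_apply, Matrix.add_apply, Matrix.sum_apply, Matrix.mul_apply,
      Matrix.vecMulVec_apply, Finset.sum_range, matW, matG, Matrix.of_apply, PiLp.sub_apply,
      mul_sub, Finset.sum_sub_distrib]
    simp only [whiten, hg]
    ring
  rw [e]
  refine (opNorm_add_le _ _).trans (add_le_add (opNorm_le_sqrt_frob _) ?_)
  refine (opNorm_sum_le _ _).trans ?_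
  rw [Finset.mul_sum]
  refine Finset.sum_le_sum fun t ht => (opNorm_vecMulVec_le _ _).trans ?_
  have ht' := Finset.mem_range.1 ht
  have h1 : ‖S.whiten erm η t ω‖ ≤ η := (norm_whitenColumn_le _ _ _).trans_eq (abs_of_pos hη)
  have h2 : ‖S.onlineGrad erm t ω - g t‖ ≤ L * ‖S.pilot erm t ω - S.pilot erm T ω‖ :=
    hL _ (S.p_mem t ht' ω) _ (S.x_mem t ht' ω) _ (M.Θ_subset_params (pilot_mem herm ht'.le ω)) _
      (M.Θ_subset_params (pilot_mem herm le_rfl ω))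
  have h3 : ‖S.pilot erm t ω - S.pilot erm T ω‖
      ≤ ‖S.pilot erm t ω - M.θ₀‖ + ‖S.pilot erm T ω - M.θ₀‖ := by
    have := norm_sub_le (S.pilot erm t ω - M.θ₀) (S.pilot erm T ω - M.θ₀)
    rwa [sub_sub_sub_cancel_right] at this
  rw [mul_assoc]
  exact mul_le_mul h1 (h2.trans (mul_le_mul_of_nonneg_left h3 hL0)) (norm_nonneg _) hη.le

/-! ### Decay in mean of the whitening remainder. -/

variable [IsProbabilityMeasure μ]

lemma integrable_residual (hA1 : M.A1) (hA2 : M.A2) (herm : IsERM M erm) {η : ℝ} (hη : 0 < η)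
    {t : ℕ} (ht : t ≤ T) : Integrable (S.residual erm η t) μ := by
  refine integrable_of_abs_le (b := d) (measurable_residual hA1 hA2 herm η ht) fun ω => ?_
  rw [residual, abs_of_nonneg (frob_nonneg _)]
  exact frob_whitenRemainder_le hη _ t

/-- One step removes at least `c η ‖Zu‖²`. Conditionally on the past, `Z` is frozen and the mean of
`‖Zu‖²` is at least `κ` times the residual, so the mean residual contracts. -/
lemma integral_residual_succ_le (hA1 : M.A1) (hA2 : M.A2) (hB1 : M.B1) (herm : IsERM M erm)
    {κ B c η : ℝ} (hD1 : S.D1 κ) (hB : M.GradBound B) (hη : 0 < η)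
    (hc : 0 ≤ c) (hcB : c * η * B ^ 2 ≤ 1) (hcd : c * (√d * B) ≤ 1) {t : ℕ} (ht : t < T) :
    ∫ ω, S.residual erm η (t + 1) ω ∂μ ≤ (1 - c * η * κ) * ∫ ω, S.residual erm η t ω ∂μ := by
  have := markov_step (S := S) hB1 ht
  set Z : Ω → Matrix (Fin d) (Fin d) ℝ :=
    fun ω => whitenRemainder η (fun s => S.onlineGrad erm s ω) t with hZ
  -- Measurability with respect to the history yields, by Doob-Dynkin, a measurable `ζ` with `Z = ζ
  -- (history)`; the integrand can then be fed to the tower property.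
  have hZm : @Measurable Ω (Fin d → Fin d → ℝ) (MeasurableSpace.comap (S.history t) inferInstance)
      _ (fun ω i j => Z ω i j) :=
    @measurable_pi_lambda _ _ _ (MeasurableSpace.comap (S.history t) inferInstance) _ _ fun i =>
      @measurable_pi_lambda _ _ _ (MeasurableSpace.comap (S.history t) inferInstance) _ _ fun j =>
        measurable_whitenRemainder (m := MeasurableSpace.comap (S.history t) inferInstance) η t
          (fun s hs => measurable_onlineGrad_of_history
            (m := MeasurableSpace.comap (S.history t) inferInstance) (π := id)
            hA1 hA2 herm ht.le (comap_measurable _) hs) i j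
  obtain ⟨ζ, hζ, hζe⟩ := hZm.exists_eq_measurable_comp
  have hZζ : ∀ ω, Z ω = ζ (S.history t ω) := fun ω => congrFun hζe ω
  set φ : (Fin t → Obs d) × Obs d → ℝ := fun q =>
    ‖mulVecE (ζ q.1) (M.cutGradF ((q.2.1, q.2.2.1), erm t q.1))‖ ^ 2 with hφ
  have mφ : Measurable φ := by
    have h1 : Measurable fun q : (Fin t → Obs d) × Obs d =>
        M.cutGradF ((q.2.1, q.2.2.1), erm t q.1) :=
      (M.measurable_cutGradF hA1 hA2).comp
        (((measurable_snd.fst).prodMk (measurable_snd.snd.fst)).prodMk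
          ((herm.measurable t).comp measurable_fst))
    exact ((measurable_mulVecE (Z := fun q : (Fin t → Obs d) × Obs d => ζ q.1) (fun i j =>
      (measurable_pi_apply j).comp ((measurable_pi_apply i).comp (hζ.comp measurable_fst)))
      h1).norm).pow_const 2
  have hφω : ∀ ω, φ (S.history t ω, S.obs t ω) = ‖mulVecE (Z ω) (S.onlineGrad erm t ω)‖ ^ 2 := by
    intro ω
    rw [hZζ, onlineGrad_eq herm ht]
    rfl
  have hφi : Integrable (fun ω => φ (S.history t ω, S.obs t ω)) μ := by
    refine integrable_of_abs_le (b := d * B ^ 2)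
      (mφ.comp ((measurable_history ht.le).prodMk (measurable_obs ht))) fun ω => ?_
    rw [hφω, abs_of_nonneg (by positivity)]
    refine (norm_mulVecE_sq_le _ _).trans ?_
    exact mul_le_mul (frob_whitenRemainder_le hη _ t)
      (pow_le_pow_left₀ (norm_nonneg _) (norm_onlineGrad_le hB herm ht ω) 2) (by positivity)
      (by positivity)
  obtain ⟨hi, he⟩ := (hasCondDistrib_obs (S := S) hB1 ht).integral_comp mφ hφi
  have hlow : κ * ∫ ω, S.residual erm η t ω ∂μ ≤ ∫ ω, φ (S.history t ω, S.obs t ω) ∂μ := by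
    rw [he, ← integral_const_mul]
    refine integral_mono_ae ((integrable_residual hA1 hA2 herm hη ht.le).const_mul κ) hi ?_
    filter_upwards [frob_le_integral_step hA1 hA2 hB1 hD1 ht] with ω hω
    have := hω _ (pilot_mem (S := S) herm ht.le ω) (Z ω)
    simp only [residual]
    refine this.trans_eq ?_
    rw [hZζ]
    rfl
  have hstep : ∀ ω, S.residual erm η (t + 1) ω
      ≤ S.residual erm η t ω - c * η * φ (S.history t ω, S.obs t ω) := by
    intro ω
    rw [hφω]
    exact frob_whitenRemainder_succ_le hη _ t (norm_onlineGrad_le hB herm ht ω) hc hcB hcd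
  have hmono := integral_mono (integrable_residual (μ := μ) hA1 hA2 herm hη (Nat.succ_le_of_lt ht))
    ((integrable_residual hA1 hA2 herm hη ht.le).sub (hφi.const_mul (c * η))) hstep
  simp only [Pi.sub_apply] at hmono
  rw [integral_sub (integrable_residual hA1 hA2 herm hη ht.le) (hφi.const_mul (c * η)),
    integral_const_mul] at hmono
  have := mul_le_mul_of_nonneg_left hlow (mul_nonneg hc hη.le)
  linarith

lemma integral_residual_le (hA1 : M.A1) (hA2 : M.A2) (hB1 : M.B1) (herm : IsERM M erm)
    {κ B c η : ℝ} (hD1 : S.D1 κ) (hB : M.GradBound B) (hη : 0 < η)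
    (hc : 0 ≤ c) (hcB : c * η * B ^ 2 ≤ 1) (hcd : c * (√d * B) ≤ 1) {t : ℕ} (ht : t ≤ T) :
    ∫ ω, S.residual erm η t ω ∂μ ≤ d * Real.exp (-(c * κ * (η * t))) := by
  induction t with
  | zero =>
    have : ∀ ω, S.residual erm η 0 ω = d := fun ω => frob_one d
    simp [this]
  | succ t ih =>
    refine (integral_residual_succ_le hA1 hA2 hB1 herm hD1 hB hη hc hcB hcd ht).trans ?_
    have h0 : 0 ≤ ∫ ω, S.residual erm η t ω ∂μ := integral_nonneg fun ω => frob_nonneg _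
    have h1 : 1 - c * η * κ ≤ Real.exp (-(c * η * κ)) := by
      have := Real.add_one_le_exp (-(c * η * κ)); linarith
    calc (1 - c * η * κ) * ∫ ω, S.residual erm η t ω ∂μ
        ≤ Real.exp (-(c * η * κ)) * (d * Real.exp (-(c * κ * (η * t)))) :=
          mul_le_mul h1 (ih (by omega)) h0 (Real.exp_pos _).le
      _ = d * Real.exp (-(c * κ * (η * (t + 1 : ℕ)))) := by
        rw [mul_left_comm, ← Real.exp_add]
        congr 2
        push_cast
        ring

end SalesProcess

/-! ### Limits -/

/-- Products of errors become sums of squares, whose means are known; the weight `r` equalizes the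
two sizes. -/
lemma mul_le_weighted_sq {r : ℝ} (hr : 0 < r) (x y : ℝ) :
    x * y ≤ (x ^ 2 / r + r * y ^ 2) / 2 := by
  have h : x ^ 2 / r + r * y ^ 2 - 2 * (x * y) = (x - r * y) ^ 2 / r := by
    field_simp
    ring
  have : 0 ≤ (x - r * y) ^ 2 / r := by positivity
  linarith

lemma sum_one_div_sqrt_le (n : ℕ) :
    ∑ t ∈ Finset.range n, 1 / √((t : ℝ) + 1) ≤ 2 * √(n : ℝ) := by
  induction n with
  | zero => simp
  | succ n ih =>
    rw [Finset.sum_range_succ]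
    have hs : 0 < √((n : ℝ) + 1) := Real.sqrt_pos.2 (by positivity)
    have h1 : √((n : ℝ) + 1) ^ 2 = n + 1 := Real.sq_sqrt (by positivity)
    have h2 : √(n : ℝ) ^ 2 = n := Real.sq_sqrt (by positivity)
    have h3 : 1 / √((n : ℝ) + 1) ≤ 2 * √((n : ℝ) + 1) - 2 * √(n : ℝ) := by
      rw [div_le_iff₀ hs]
      nlinarith [sq_nonneg (√((n : ℝ) + 1) - √(n : ℝ))]
    push_cast
    linarith

lemma measure_ge_le_ofReal {Ω : Type*} [MeasurableSpace Ω] {μ : Measure Ω}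
    [IsProbabilityMeasure μ] {g : Ω → ℝ} (h0 : ∀ ω, 0 ≤ g ω) (hg : Integrable g μ) {ε e : ℝ}
    (hε : 0 < ε) (he : ∫ ω, g ω ∂μ ≤ e) : μ {ω | ε ≤ g ω} ≤ ENNReal.ofReal (e / ε) := by
  have h := mul_meas_ge_le_integral_of_nonneg (ae_of_all μ h0) hg ε
  rw [← ofReal_measureReal (measure_ne_top μ _)]
  refine ENNReal.ofReal_le_ofReal ?_
  rw [le_div_iff₀ hε]
  linarith

/-- Multiplying by a power of `T` of exponent at most `α` preserves convergence to zero. -/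
lemma tendsto_mul_rpow_of_le {η : ℕ → ℝ} {α β : ℝ} (hβα : β ≤ α)
    (h : Tendsto (fun T : ℕ => η T * (T : ℝ) ^ α) atTop (𝓝 0)) :
    Tendsto (fun T : ℕ => η T * (T : ℝ) ^ β) atTop (𝓝 0) := by
  refine squeeze_zero_norm' ?_ (tendsto_zero_iff_norm_tendsto_zero.1 h)
  filter_upwards [eventually_ge_atTop 1] with T hT
  have hT' : (1 : ℝ) ≤ T := by exact_mod_cast hT
  rw [norm_mul, norm_mul]
  refine mul_le_mul_of_nonneg_left ?_ (norm_nonneg _)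
  rw [Real.norm_of_nonneg (by positivity), Real.norm_of_nonneg (by positivity)]
  exact Real.rpow_le_rpow_of_exponent_le hT' hβα

lemma tendsto_measure_zero_of_le_ofReal {Ω : ℕ → Type*} [∀ T, MeasurableSpace (Ω T)]
    {μ : (T : ℕ) → Measure (Ω T)} {A : (T : ℕ) → Set (Ω T)} {e : ℕ → ℝ}
    (h : ∀ᶠ T in atTop, (μ T) (A T) ≤ ENNReal.ofReal (e T)) (he : Tendsto e atTop (𝓝 0)) :
    Tendsto (fun T => (μ T) (A T)) atTop (𝓝 0) := by
  have h0 := ENNReal.tendsto_ofReal he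
  rw [ENNReal.ofReal_zero] at h0
  exact tendsto_of_tendsto_of_tendsto_of_le_of_le' tendsto_const_nhds h0
    (Eventually.of_forall fun _ => zero_le) h

/-! ### The bias scaled by `√T`. -/

namespace SalesProcess

section
variable {d : ℕ} {M : Model d} {T : ℕ} {Ω : Type*} [MeasurableSpace Ω] {μ : Measure Ω}
  {S : SalesProcess M T μ} {erm : (n : ℕ) → (Fin n → Obs d) → Vec d}

/-- An upper bound of the scaled bias with a simple mean. -/
noncomputable def biasBound (S : SalesProcess M T μ) (erm : (n : ℕ) → (Fin n → Obs d) → Vec d)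
    (η L r : ℝ) (ω : Ω) : ℝ :=
  (S.residual erm η T ω / r + r * (T * ‖S.pilot erm T ω - M.θ₀‖ ^ 2)) / 2
    + η * L * ∑ t ∈ Finset.range T,
      ((T * ‖S.pilot erm T ω - M.θ₀‖ ^ 2 / √((t : ℝ) + 1)
          + √((t : ℝ) + 1) * ‖S.pilot erm t ω - M.θ₀‖ ^ 2) / 2
        + √(T : ℝ) * ‖S.pilot erm T ω - M.θ₀‖ ^ 2)
    + √(T : ℝ) * ‖S.pilot erm T ω - M.θ₀‖ ^ 2

lemma biasBound_nonneg {η L r : ℝ} (hη : 0 < η) (hL : 0 ≤ L) (hr : 0 < r) (ω : Ω) :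
    0 ≤ S.biasBound erm η L r ω := by
  have : 0 ≤ S.residual erm η T ω := frob_nonneg _
  unfold biasBound
  positivity

lemma bias_mul_sqrt_le (herm : IsERM M erm) {L η r : ℝ} (hη : 0 < η) (hr : 0 < r)
    (hL0 : 0 ≤ L) (hL : ∀ p ∈ M.prices, ∀ x ∈ M.contexts, ∀ θ ∈ M.params, ∀ θ' ∈ M.params,
      ‖gradient (M.f p x) θ - gradient (M.f p x) θ'‖ ≤ L * ‖θ - θ'‖) (ω : Ω) :
    (opNorm (1 - S.matW (S.whiten erm η) ω * S.matG erm ω) * ‖S.pilot erm T ω - M.θ₀‖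
      + ‖S.pilot erm T ω - M.θ₀‖ ^ 2) * √(T : ℝ) ≤ S.biasBound erm η L r ω := by
  have hop := opNorm_bias_le (S := S) herm hη hL0 hL ω
  unfold biasBound
  set a : ℕ → ℝ := fun t => ‖S.pilot erm t ω - M.θ₀‖ with ha
  have ha0 : ∀ t, 0 ≤ a t := fun t => norm_nonneg _
  set z := S.residual erm η T ω
  have hz : 0 ≤ z := frob_nonneg _
  have hT2 : √(T : ℝ) ^ 2 = T := Real.sq_sqrt (by positivity)
  -- The weight `r` will satisfy `𝔼 z ≤ d r²`, while `T (a T)²` has bounded mean, so both halves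
  -- have mean `O(r)`.
  have h1 : √z * (a T * √(T : ℝ)) ≤ (z / r + r * (T * a T ^ 2)) / 2 := by
    have := mul_le_weighted_sq hr (√z) (a T * √(T : ℝ))
    rw [Real.sq_sqrt hz, mul_pow, hT2, mul_comm (a T ^ 2)] at this
    exact this
  -- With weight `√(t+1)` both squares have mean `O(1/√(t+1))`, because `(a t)²` has mean
  -- `O(1/(t+1))`.
  have h2 : (∑ t ∈ Finset.range T, (a t + a T)) * (a T * √(T : ℝ)) ≤ ∑ t ∈ Finset.range T,
      ((T * a T ^ 2 / √((t : ℝ) + 1) + √((t : ℝ) + 1) * a t ^ 2) / 2 + √(T : ℝ) * a T ^ 2) := by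
    rw [Finset.sum_mul]
    refine Finset.sum_le_sum fun t _ => ?_
    have := mul_le_weighted_sq (Real.sqrt_pos.2 (by positivity : (0 : ℝ) < t + 1))
      (a T * √(T : ℝ)) (a t)
    rw [mul_pow, hT2, mul_comm (a T ^ 2)] at this
    nlinarith
  have h3 := mul_le_mul_of_nonneg_right hop (mul_nonneg (ha0 T) (Real.sqrt_nonneg (T : ℝ)))
  have h4 := mul_le_mul_of_nonneg_left h2 (mul_nonneg hη.le hL0)
  change _ ≤ (√z + η * L * ∑ t ∈ Finset.range T, (a t + a T)) * (a T * √(T : ℝ)) at h3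
  change (_ * a T + a T ^ 2) * √(T : ℝ) ≤ (z / r + r * (T * a T ^ 2)) / 2
    + η * L * ∑ t ∈ Finset.range T,
      ((T * a T ^ 2 / √((t : ℝ) + 1) + √((t : ℝ) + 1) * a t ^ 2) / 2 + √(T : ℝ) * a T ^ 2)
    + √(T : ℝ) * a T ^ 2
  rw [add_mul, mul_assoc] at h3 ⊢
  linarith

lemma integral_biasBound_le [IsProbabilityMeasure μ] {η L r C : ℝ} (hη : 0 < η) (hL : 0 ≤ L)
    (hr : 0 < r) (hC : 0 ≤ C) (hT : 0 < T) (hzi : Integrable (S.residual erm η T) μ)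
    (hz : ∫ ω, S.residual erm η T ω ∂μ ≤ d * r ^ 2)
    (ha : ∀ n ≤ T, Integrable (fun ω => ‖S.pilot erm n ω - M.θ₀‖ ^ 2) μ ∧
      ∫ ω, ‖S.pilot erm n ω - M.θ₀‖ ^ 2 ∂μ ≤ C / (n + 1)) :
    Integrable (S.biasBound erm η L r) μ ∧ ∫ ω, S.biasBound erm η L r ω ∂μ
      ≤ (d + C) / 2 * r + 3 * C * L * (η * √(T : ℝ)) + C / √(T : ℝ) := by
  have hT' : (0 : ℝ) < T := by exact_mod_cast hT
  have hsT : 0 < √(T : ℝ) := Real.sqrt_pos.2 hT'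
  have hT2 : √(T : ℝ) ^ 2 = T := Real.sq_sqrt hT'.le
  have iT := (ha T le_rfl).1
  have bT : T * ∫ ω, ‖S.pilot erm T ω - M.θ₀‖ ^ 2 ∂μ ≤ C := by
    refine (mul_le_mul_of_nonneg_left (ha T le_rfl).2 hT'.le).trans ?_
    rw [← mul_div_assoc, div_le_iff₀ (by positivity)]
    nlinarith
  have bT2 : √(T : ℝ) * ∫ ω, ‖S.pilot erm T ω - M.θ₀‖ ^ 2 ∂μ ≤ C / √(T : ℝ) := by
    rw [le_div_iff₀ hsT]
    nlinarith
  have j1 : Integrable (fun ω => (S.residual erm η T ω / r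
      + r * (T * ‖S.pilot erm T ω - M.θ₀‖ ^ 2)) / 2) μ :=
    ((hzi.div_const r).add ((iT.const_mul _).const_mul r)).div_const 2
  have b1 : ∫ ω, (S.residual erm η T ω / r
      + r * (T * ‖S.pilot erm T ω - M.θ₀‖ ^ 2)) / 2 ∂μ ≤ (d + C) / 2 * r := by
    rw [integral_div, integral_add (hzi.div_const r) ((iT.const_mul _).const_mul r), integral_div,
      integral_const_mul, integral_const_mul]
    have h1 : (∫ ω, S.residual erm η T ω ∂μ) / r ≤ d * r := by
      rw [div_le_iff₀ hr]; linarith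
    have h2 := mul_le_mul_of_nonneg_left bT hr.le
    linarith
  have j2 : ∀ t ∈ Finset.range T, Integrable (fun ω =>
      (T * ‖S.pilot erm T ω - M.θ₀‖ ^ 2 / √((t : ℝ) + 1)
          + √((t : ℝ) + 1) * ‖S.pilot erm t ω - M.θ₀‖ ^ 2) / 2
        + √(T : ℝ) * ‖S.pilot erm T ω - M.θ₀‖ ^ 2) μ := fun t ht =>
    ((((iT.const_mul _).div_const _).add
      ((ha t (Finset.mem_range.1 ht).le).1.const_mul _)).div_const 2).add (iT.const_mul _)
  have b2 : ∀ t ∈ Finset.range T, ∫ ω,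
      ((T * ‖S.pilot erm T ω - M.θ₀‖ ^ 2 / √((t : ℝ) + 1)
          + √((t : ℝ) + 1) * ‖S.pilot erm t ω - M.θ₀‖ ^ 2) / 2
        + √(T : ℝ) * ‖S.pilot erm T ω - M.θ₀‖ ^ 2) ∂μ
      ≤ C * (1 / √((t : ℝ) + 1)) + C / √(T : ℝ) := fun t ht => by
    have htT := (Finset.mem_range.1 ht).le
    have hst : 0 < √((t : ℝ) + 1) := Real.sqrt_pos.2 (by positivity)
    have i1 : Integrable (fun ω => T * ‖S.pilot erm T ω - M.θ₀‖ ^ 2 / √((t : ℝ) + 1)) μ :=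
      (iT.const_mul _).div_const _
    have i2 : Integrable (fun ω => √((t : ℝ) + 1) * ‖S.pilot erm t ω - M.θ₀‖ ^ 2) μ :=
      (ha t htT).1.const_mul _
    have i12 : Integrable (fun ω => (T * ‖S.pilot erm T ω - M.θ₀‖ ^ 2 / √((t : ℝ) + 1)
        + √((t : ℝ) + 1) * ‖S.pilot erm t ω - M.θ₀‖ ^ 2) / 2) μ := (i1.add i2).div_const 2
    rw [integral_add i12 (iT.const_mul _), integral_div, integral_add i1 i2, integral_div,
      integral_const_mul, integral_const_mul, integral_const_mul]
    have h1 : (T * ∫ ω, ‖S.pilot erm T ω - M.θ₀‖ ^ 2 ∂μ) / √((t : ℝ) + 1)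
        ≤ C * (1 / √((t : ℝ) + 1)) := by
      rw [mul_one_div]
      gcongr
    have h2 : √((t : ℝ) + 1) * ∫ ω, ‖S.pilot erm t ω - M.θ₀‖ ^ 2 ∂μ
        ≤ C * (1 / √((t : ℝ) + 1)) := by
      refine (mul_le_mul_of_nonneg_left (ha t htT).2 hst.le).trans_eq ?_
      have : (t : ℝ) + 1 = √((t : ℝ) + 1) ^ 2 := (Real.sq_sqrt (by positivity)).symm
      nth_rewrite 2 [this]
      field_simp
    linarith
  have j2s := integrable_finsetSum _ j2
  have b2s : ∫ ω, ∑ t ∈ Finset.range T,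
      ((T * ‖S.pilot erm T ω - M.θ₀‖ ^ 2 / √((t : ℝ) + 1)
          + √((t : ℝ) + 1) * ‖S.pilot erm t ω - M.θ₀‖ ^ 2) / 2
        + √(T : ℝ) * ‖S.pilot erm T ω - M.θ₀‖ ^ 2) ∂μ ≤ 3 * C * √(T : ℝ) := by
    rw [integral_finsetSum _ j2]
    -- Of the factor 3, the sum of `1/√(t+1)` contributes 2 and the `T` copies of `C/√T` contribute
    -- 1.
    refine (Finset.sum_le_sum b2).trans ?_
    rw [Finset.sum_add_distrib, ← Finset.mul_sum, Finset.sum_const, Finset.card_range,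
      nsmul_eq_mul]
    have h1 := mul_le_mul_of_nonneg_left (sum_one_div_sqrt_le T) hC
    have h2 : (T : ℝ) * (C / √(T : ℝ)) = C * √(T : ℝ) := by
      nth_rewrite 1 [← hT2]
      field_simp
    linarith
  have j12 : Integrable (fun ω => (S.residual erm η T ω / r
      + r * (T * ‖S.pilot erm T ω - M.θ₀‖ ^ 2)) / 2 + η * L * ∑ t ∈ Finset.range T,
      ((T * ‖S.pilot erm T ω - M.θ₀‖ ^ 2 / √((t : ℝ) + 1)
          + √((t : ℝ) + 1) * ‖S.pilot erm t ω - M.θ₀‖ ^ 2) / 2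
        + √(T : ℝ) * ‖S.pilot erm T ω - M.θ₀‖ ^ 2)) μ := j1.add (j2s.const_mul _)
  refine ⟨j12.add (iT.const_mul _), ?_⟩
  simp only [biasBound]
  rw [integral_add j12 (iT.const_mul _), integral_add j1 (j2s.const_mul _), integral_const_mul,
    integral_const_mul]
  have := mul_le_mul_of_nonneg_left b2s (mul_nonneg hη.le hL)
  linarith

/-- Outside a small event the bias ratio is controlled by `biasBound`. -/
lemma abs_biasRatio_lt (herm : IsERM M erm) {L η r c ε : ℝ} (hη : 0 < η) (hr : 0 < r)
    (hL0 : 0 ≤ L) (hL : ∀ p ∈ M.prices, ∀ x ∈ M.contexts, ∀ θ ∈ M.params, ∀ θ' ∈ M.params,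
      ‖gradient (M.f p x) θ - gradient (M.f p x) θ'‖ ≤ L * ‖θ - θ'‖) (hT : 0 < T) (hc : 0 < c)
    {ω : Ω} (hlam : c / T ≤ S.lamWDW (S.whiten erm η) ω)
    (hω : S.biasBound erm η L r ω < ε * √(min 1 c)) :
    |S.biasRatio erm (S.whiten erm η) ω| < ε := by
  have hT' : (1 : ℝ) ≤ T := by exact_mod_cast hT
  have hsT : 0 < √(T : ℝ) := Real.sqrt_pos.2 (by linarith)
  have hc0 : 0 < min 1 c := lt_min one_pos hc
  have hsc : 0 < √(min 1 c) := Real.sqrt_pos.2 hc0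
  have hden : √(min 1 c) / √(T : ℝ) ≤ min 1 √(S.lamWDW (S.whiten erm η) ω) := by
    refine le_min ?_ ?_
    · rw [div_le_one hsT]
      exact Real.sqrt_le_sqrt ((min_le_left _ _).trans hT')
    · rw [← Real.sqrt_div hc0.le]
      refine Real.sqrt_le_sqrt (le_trans ?_ hlam)
      gcongr
      exact min_le_right _ _
  have hden0 : 0 < min 1 √(S.lamWDW (S.whiten erm η) ω) := lt_of_lt_of_le (by positivity) hden
  have hb := bias_mul_sqrt_le (S := S) herm hη hr hL0 hL ω
  unfold biasRatio
  set x := opNorm (1 - S.matW (S.whiten erm η) ω * S.matG erm ω) * ‖S.pilot erm T ω - M.θ₀‖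
  set y := ‖S.pilot erm T ω - M.θ₀‖ ^ 2
  have hx : 0 ≤ x := mul_nonneg (opNorm_nonneg _) (norm_nonneg _)
  have hy : 0 ≤ y := sq_nonneg _
  -- Forced by `hω`, since `biasBound` dominates a nonnegative quantity.
  have hε : 0 < ε := by
    by_contra h
    have := mul_nonpos_of_nonpos_of_nonneg (not_lt.1 h) hsc.le
    linarith [mul_nonneg (add_nonneg hx hy) hsT.le]
  rw [abs_of_nonneg (div_nonneg (hx.trans (le_max_left _ _)) hden0.le), div_lt_iff₀ hden0]
  calc max x y ≤ x + y := max_le (by linarith) (by linarith)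
    _ < ε * (√(min 1 c) / √(T : ℝ)) := by
      rw [← mul_div_assoc, lt_div_iff₀ hsT]
      exact hb.trans_lt hω
    _ ≤ _ := mul_le_mul_of_nonneg_left hden hε.le

end

end SalesProcess

end DynamicPricing

/-! ### Choice of constants and passage to the limit. -/

theorem mainTheorem5 {d : ℕ} (hd : 0 < d) (M : DynamicPricing.Model d)
    (hA1 : M.A1) (hA2 : M.A2) (hB1 : M.B1) (hB2 : M.B2) (hC1 : M.C1) (hC2 : M.C2)
    (Ω : ℕ → Type*) [∀ T, MeasurableSpace (Ω T)] (μ : (T : ℕ) → Measure (Ω T))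
    [∀ T, IsProbabilityMeasure (μ T)]
    (S : (T : ℕ) → DynamicPricing.SalesProcess M T (μ T))
    (hD1 : ∃ κ₀ : ℝ, 0 < κ₀ ∧ ∀ T, (S T).D1 κ₀)
    (erm : (n : ℕ) → (Fin n → DynamicPricing.Obs d) → DynamicPricing.Vec d)
    (herm : DynamicPricing.IsERM M erm)
    (η : ℕ → ℝ) (hη : Tendsto (fun T : ℕ => η T * (T : ℝ)) atTop atTop)
    (hηδ : ∃ δ : ℝ, 0 < δ ∧ Tendsto (fun T : ℕ => η T * (T : ℝ) ^ (1 / 2 + δ)) atTop (𝓝 0)) :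
    DynamicPricing.WhiteningConditions S erm (fun T => (S T).whiten erm (η T)) ∧
      ∃ c : ℝ, 0 < c ∧
        Tendsto (fun T : ℕ => (μ T) {ω | c / T ≤ (S T).lamWDW ((S T).whiten erm (η T)) ω})
          atTop (𝓝 1) := by
  obtain ⟨κ, hκ, hD⟩ := hD1
  obtain ⟨C, hC0, hC⟩ := DynamicPricing.SalesProcess.exists_integral_pilot_error_sq_le hd hA1 hB1
    hC1 hC2 hκ herm
  obtain ⟨B₀, hB₀⟩ := hA2.bounded
  set B := max B₀ 1
  have hBpos : 0 < B := lt_max_of_lt_right one_pos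
  have hB : M.GradBound B := fun p hp x hx θ hθ =>
    (hB₀ p hp x hx θ hθ).2.trans (le_max_left _ _)
  obtain ⟨L₀, hL₀⟩ := hA2.lipschitz
  set L := max L₀ 0
  have hL0 : 0 ≤ L := le_max_right _ _
  have hL : ∀ p ∈ M.prices, ∀ x ∈ M.contexts, ∀ θ ∈ M.params, ∀ θ' ∈ M.params,
      ‖gradient (M.f p x) θ - gradient (M.f p x) θ'‖ ≤ L * ‖θ - θ'‖ :=
    fun p hp x hx θ hθ θ' hθ' => (hL₀ p hp x hx θ hθ θ' hθ').trans
      (mul_le_mul_of_nonneg_right (le_max_left _ _) (norm_nonneg _))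
  obtain ⟨a, b, ha, hν⟩ := hB2.bounds
  have hd' : (0 : ℝ) < d := by exact_mod_cast hd
  obtain ⟨δ, hδ, hηδ⟩ := hηδ
  have hη_sqrt : Tendsto (fun T : ℕ => η T * √(T : ℝ)) atTop (𝓝 0) := by
    simp_rw [Real.sqrt_eq_rpow]
    exact DynamicPricing.tendsto_mul_rpow_of_le (by linarith) hηδ
  have hη_zero : Tendsto η atTop (𝓝 0) := by
    have := DynamicPricing.tendsto_mul_rpow_of_le (β := 0) (by linarith) hηδ
    simpa using this
  have hη_pos : ∀ᶠ T in atTop, 0 < η T := by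
    filter_upwards [hη.eventually_gt_atTop 0] with T hT
    exact pos_of_mul_pos_left hT (Nat.cast_nonneg T)
  -- The largest `c` with `c ‖Zu‖ ≤ 1` guaranteed by `‖Zu‖ ≤ √d B`; the other step-size condition
  -- holds eventually because `η → 0`.
  set c := 1 / (√(d : ℝ) * B) with hc
  have hsd : 0 < √(d : ℝ) := Real.sqrt_pos.2 hd'
  have hcpos : 0 < c := by positivity
  have hcd : c * (√(d : ℝ) * B) ≤ 1 := by
    rw [hc, one_div, inv_mul_cancel₀ (by positivity)]
  have hcB : ∀ᶠ T in atTop, c * η T * B ^ 2 ≤ 1 := by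
    have h : Tendsto (fun T => c * η T * B ^ 2) atTop (𝓝 (c * 0 * B ^ 2)) :=
      (hη_zero.const_mul c).mul_const _
    rw [mul_zero, zero_mul] at h
    exact h.eventually_le_const one_pos
  -- The square root of the decay rate of the mean residual, so that the mean is at most `d r²`.
  set r : ℕ → ℝ := fun T => Real.exp (-(c * κ * (η T * T)) / 2) with hr
  have hr_pos : ∀ T, 0 < r T := fun T => Real.exp_pos _
  have hr_zero : Tendsto r atTop (𝓝 0) := by
    refine Real.tendsto_exp_atBot.comp ?_
    exact (tendsto_neg_atTop_atBot.comp (hη.const_mul_atTop (by positivity))).atBot_div_const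
      two_pos
  have hres : ∀ᶠ T in atTop, Integrable ((S T).residual erm (η T) T) (μ T) ∧
      ∫ ω, (S T).residual erm (η T) T ω ∂(μ T) ≤ d * r T ^ 2 := by
    filter_upwards [hη_pos, hcB] with T hηT hcBT
    refine ⟨DynamicPricing.SalesProcess.integrable_residual hA1 hA2 herm hηT le_rfl, ?_⟩
    refine (DynamicPricing.SalesProcess.integral_residual_le hA1 hA2 hB1 herm (hD T) hB hηT
      hcpos.le hcBT hcd le_rfl).trans_eq ?_
    rw [hr, ← Real.exp_nat_mul]
    congr 2
    push_cast
    ring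
  have hbad : ∀ᶠ T in atTop, (μ T) {ω | 1 / 4 ≤ (S T).residual erm (η T) T ω}
      ≤ ENNReal.ofReal (d * r T ^ 2 / (1 / 4)) := by
    filter_upwards [hres] with T hT
    exact DynamicPricing.measure_ge_le_ofReal (fun ω => DynamicPricing.frob_nonneg _) hT.1
      (by norm_num) hT.2
  have hdr_zero : Tendsto (fun T => d * r T ^ 2 / (1 / 4)) atTop (𝓝 0) := by
    simpa using ((hr_zero.pow 2).const_mul (d : ℝ)).div_const (1 / 4)
  have hbad_zero := DynamicPricing.tendsto_measure_zero_of_le_ofReal hbad hdr_zero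
  set c₁ := a ^ 2 / (4 * B ^ 2)
  have hc₁ : 0 < c₁ := by positivity
  have hlam : ∀ T, 0 < T → ∀ ω, (S T).residual erm (η T) T ω < 1 / 4 →
      c₁ / T ≤ (S T).lamWDW ((S T).whiten erm (η T)) ω := fun T hT ω hω =>
    DynamicPricing.SalesProcess.le_lamWDW hd herm ha hν hB hBpos hT hω.le
  have mwhiten : ∀ T, ∀ t < T, Measurable ((S T).whiten erm (η T) t) := fun T t ht =>
    DynamicPricing.SalesProcess.measurable_whiten (π := id) hA1 hA2 herm (η T) ht
      (DynamicPricing.SalesProcess.measurable_history ht.le) ((S T).x_measurable t ht)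
      ((S T).p_measurable t ht)
  have hnorm : ∀ T ω, ∑ t ∈ Finset.range T, ‖(S T).whiten erm (η T) t ω‖ ^ 3
      ≤ T * |η T| ^ 3 := fun T ω => by
    refine (Finset.sum_le_card_nsmul _ _ (|η T| ^ 3) fun t _ => ?_).trans_eq (by simp)
    exact pow_le_pow_left₀ (norm_nonneg _) (DynamicPricing.norm_whitenColumn_le _ _ _) 3
  have hnorm_int : ∀ T, Integrable
      (fun ω => ∑ t ∈ Finset.range T, ‖(S T).whiten erm (η T) t ω‖ ^ 3) (μ T) := fun T => by
    refine DynamicPricing.SalesProcess.integrable_of_abs_le (b := T * |η T| ^ 3)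
      (Finset.measurable_fun_sum _ fun t ht =>
        (mwhiten T t (Finset.mem_range.1 ht)).norm.pow_const 3) fun ω => ?_
    rw [abs_of_nonneg (Finset.sum_nonneg fun _ _ => by positivity)]
    exact hnorm T ω
  refine ⟨⟨fun T t ht => DynamicPricing.SalesProcess.measurable_info_whiten hA1 hA2 herm (η T) _ ht,
    hnorm_int, ?_, ?_⟩, c₁, hc₁, ?_⟩
  · have h3 : Tendsto (fun T : ℕ => |η T * √(T : ℝ)| ^ 3) atTop (𝓝 0) := by
      simpa using hη_sqrt.abs.pow 3
    refine squeeze_zero' (Eventually.of_forall fun T => integral_nonneg fun ω =>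
      Finset.sum_nonneg fun _ _ => by positivity) ?_ h3
    filter_upwards [eventually_ge_atTop 1] with T hT
    have hT' : (1 : ℝ) ≤ T := by exact_mod_cast hT
    refine (integral_mono (hnorm_int T) (integrable_const _) (hnorm T)).trans ?_
    simp only [integral_const, probReal_univ, one_smul]
    rw [abs_mul, abs_of_nonneg (Real.sqrt_nonneg _), mul_pow, mul_comm]
    refine mul_le_mul_of_nonneg_left ?_ (by positivity)
    -- The bound `T |η|³` is compared with `|η √T|³` through `T ≤ T^(3/2)`.
    have h1 : 1 ≤ √(T : ℝ) := Real.one_le_sqrt.2 hT'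
    calc (T : ℝ) = √(T : ℝ) ^ 2 := (Real.sq_sqrt (by positivity)).symm
      _ ≤ √(T : ℝ) ^ 3 := pow_le_pow_right₀ h1 (by norm_num)
  · intro ε hε
    have hεc : 0 < ε * √(min 1 c₁) := mul_pos hε (Real.sqrt_pos.2 (lt_min one_pos hc₁))
    set e : ℕ → ℝ := fun T =>
      (d + C) / 2 * r T + 3 * C * L * (η T * √(T : ℝ)) + C / √(T : ℝ) with he
    have he_zero : Tendsto (fun T => e T / (ε * √(min 1 c₁))) atTop (𝓝 0) := by
      have h1 : Tendsto (fun T : ℕ => C / √(T : ℝ)) atTop (𝓝 0) :=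
        Tendsto.const_div_atTop (Real.tendsto_sqrt_atTop.comp tendsto_natCast_atTop_atTop) C
      have h2 := (((hr_zero.const_mul ((d + C) / 2)).add
        (hη_sqrt.const_mul (3 * C * L))).add h1).div_const (ε * √(min 1 c₁))
      simpa using h2
    have hbias : ∀ᶠ T in atTop,
        (μ T) {ω | ε * √(min 1 c₁) ≤ (S T).biasBound erm (η T) L (r T) ω}
          ≤ ENNReal.ofReal (e T / (ε * √(min 1 c₁))) := by
      filter_upwards [hres, hη_pos, eventually_gt_atTop 0] with T hT hηT hT0
      have h := DynamicPricing.SalesProcess.integral_biasBound_le hηT hL0 (hr_pos T) hC0 hT0 hT.1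
        hT.2 (hC T (Ω T) (μ T) (S T) (hD T))
      exact DynamicPricing.measure_ge_le_ofReal
        (DynamicPricing.SalesProcess.biasBound_nonneg hηT hL0 (hr_pos T)) h.1 hεc h.2
    have hsum := hbad_zero.add
      (DynamicPricing.tendsto_measure_zero_of_le_ofReal hbias he_zero)
    rw [add_zero] at hsum
    refine tendsto_of_tendsto_of_tendsto_of_le_of_le' tendsto_const_nhds hsum
      (Eventually.of_forall fun _ => zero_le) ?_
    filter_upwards [hη_pos, eventually_gt_atTop 0] with T hηT hT0
    -- The ratio can reach `ε` only if the residual is at least `1/4` or the scaled bias bound is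
    -- large. Monotonicity and subadditivity need no measurability of the ratio.
    refine (measure_mono fun ω hω => ?_).trans (measure_union_le _ _)
    by_contra hn
    simp only [Set.mem_union, Set.mem_ofPred_eq, not_or, not_le] at hn
    exact absurd hω (not_le.2 (DynamicPricing.SalesProcess.abs_biasRatio_lt herm hηT (hr_pos T)
      hL0 hL hT0 hc₁ (hlam T hT0 ω hn.1) hn.2))
  · have hlow : Tendsto (fun T => 1 - (μ T) {ω | 1 / 4 ≤ (S T).residual erm (η T) T ω})
        atTop (𝓝 1) := by
      simpa using ENNReal.Tendsto.sub (tendsto_const_nhds (x := 1)) hbad_zero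
        (Or.inl ENNReal.one_ne_top)
    refine tendsto_of_tendsto_of_tendsto_of_le_of_le' hlow tendsto_const_nhds ?_
      (Eventually.of_forall fun _ => prob_le_one)
    filter_upwards [eventually_gt_atTop 0] with T hT0
    have hm : MeasurableSet {ω | 1 / 4 ≤ (S T).residual erm (η T) T ω} :=
      measurableSet_le measurable_const
        (DynamicPricing.SalesProcess.measurable_residual hA1 hA2 herm (η T) le_rfl)
    rw [← prob_compl_eq_one_sub hm]
    exact measure_mono fun ω hω => hlam T hT0 ω (not_le.1 hω)
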